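/- **Setting.** A dynamic domain over a finite set $\mathit{Prop}$ is $\mathcal D=(S,s_0,\delta,\lambda)$ with a finite set of states $S$, $s_0\in S$, a serial transition relation $\delta\subseteq S\times S$ and a labelling $\lambda:S\to 2^{\mathit{Prop}}$. A trace is a finite nonempty sequence $s_0\cdots s_n$ starting in the initial state with $(s_i,s_{i+1})\in\delta$. Let $\mathcal D_A=(S,s_0,\delta^A,\lambda^A)$ and $\mathcal D_B=(T,t_0,\delta^B,\lambda^B)$ be dynamic domains over disjoint finite sets $\mathit{Prop}^A,\mathit{Prop}^B$. A strategy is a function $\sigma:S^+\to T$; it is executable if $\sigma(s_0)=t_0$ and, for every trace $\tau=s_0\cdots s_n$ of $\mathcal D_A$, the sequence $\tilde\sigma(\tau)=\sigma(s_0)\,\sigma(s_0s_1)\cdots\sigma(s_0\cdots s_n)$ is a trace of $\mathcal D_B$. Let $\Phi=\bigwedge_{i=1}^k\Box(\varphi_i\to\psi_i)$ be a point-wise mapping specification, i.e. an LTL$_f$ formula (linear temporal logic on finite traces) with $\varphi_i$ a Boolean formula over $\mathit{Prop}^A$ and $\psi_i$ a Boolean formula over $\mathit{Prop}^B$. With $A$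 as the stop agent, a solution of the instance $\mathcal P=(\mathcal D_A,\mathcal D_B,\Phi,A)$ of Mimicking Behaviors in Separated Domains (MBSD) is an executable strategy $\sigma$ such that for every trace $\tau$ of $\mathcal D_A$, writing $\tau=s_0\cdots s_n$ and $\tilde\sigma(\tau)=t_0\cdots t_n$, the word $(\lambda^A(s_0)\cup\lambda^B(t_0))\cdots(\lambda^A(s_n)\cup\lambda^B(t_n))$ satisfies $\Phi$. Let $|\mathcal D|$ be the number of states, transitions and propositions of $\mathcal D$, and $|\Phi|$ the number of connectives of $\Phi$. **Theorem.** 1. *Reduction.* Consider the safety game in which both players have the nodes $S\times T$, the initial node is $(s_0,t_0)$ (a node of player 1), player 1 moves from $(s,t)$ to $(s',t)$ with $(s,s')\in\delta^A$, and player 2 moves from $(s,t)$ to $(s,t')$ with $(t,t')\in\delta^B$. A strategy of player 2 (a function from nonempty sequences of nodes of player 2 to nodes of player 1) is winning if it always prescribes legal moves and, in each play compatible with it, all nodes of player 1 lie in $g=\{(s,t)\mid \lambda^A(s)\cup\lambda^B(t)\models\bigwedge_{i=1}^k(\varphi_i\to\psi_i)\}$. Then $\mathcal P$ has a solution if and only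 if player 2 has a winning strategy in this game. 2. *Complexity.* MBSD for point-wise mapping specifications with stop agent $A$ is solvable in polynomial time in combined, mapping and domain complexity. That is, there is an algorithm which, for every such instance $\mathcal P$ (explicitly represented), decides whether $\mathcal P$ has a solution and, if so, outputs one in the form of a table $f:S\times T\to T$ (the strategy starts in $t_0$ and, when $A$ has moved to $s$ and $B$ is in $t$, moves to $f(s,t)$), and whose running time is - (combined complexity) bounded by a polynomial in $|\mathcal D_A|+|\mathcal D_B|+|\Phi|$; - (mapping complexity) for each $d$, bounded by a polynomial in $|\Phi|$ on all instances with $|\mathcal D_A|+|\mathcal D_B|\le d$; - (domain complexity) for each $d$, bounded by a polynomial in $|\mathcal D_A|+|\mathcal D_B|$ on all instances with $|\Phi|\le d$. -/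

import Mathlib

namespace MBSD

/-! ## Boolean formulas and linear temporal logic on finite traces -/

/-- Boolean formulas over the propositions `P`. -/
inductive BoolFormula (P : Type*) where
  | atom (p : P)
  | neg (φ : BoolFormula P)
  | and (φ ψ : BoolFormula P)
  | or (φ ψ : BoolFormula P)

namespace BoolFormula

/-- Truth of a Boolean formula under the interpretation that makes exactly the propositions in
`a` true. -/
def Holds {P : Type*} (a : Finset P) : BoolFormula P → Prop
  | atom p => p ∈ a
  | neg φ => ¬ Holds a φ
  | and φ ψ => Holds a φ ∧ Holds a ψ
  | or φ ψ => Holds a φ ∨ Holds a ψ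

/-- The size of a Boolean formula: the number of connectives occurring in it. -/
def size {P : Type*} : BoolFormula P → ℕ
  | atom _ => 0
  | neg φ => size φ + 1
  | and φ ψ => size φ + size ψ + 1
  | or φ ψ => size φ + size ψ + 1

end BoolFormula

/-- Formulas of linear temporal logic on finite traces; `untl` is "until". The constant `tru`
(true) is primitive. -/
inductive LTLf (P : Type*) where
  | tru
  | atom (p : P)
  | and (φ ψ : LTLf P)
  | neg (φ : LTLf P)
  | next (φ : LTLf P)
  | untl (φ ψ : LTLf P)

namespace LTLf

/-- `φ ∨ ψ`. -/
def or {P : Type*} (φ ψ : LTLf P) : LTLf P := neg (and (neg φ) (neg ψ))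

/-- `φ → ψ`. -/
def imp {P : Type*} (φ ψ : LTLf P) : LTLf P := neg (and φ (neg ψ))

/-- "Eventually `φ`". -/
def eventually {P : Type*} (φ : LTLf P) : LTLf P := untl tru φ

/-- "Always `φ`". -/
def always {P : Type*} (φ : LTLf P) : LTLf P := neg (eventually (neg φ))

/-- Finite conjunctions; the empty one is true. -/
def conj {P : Type*} (l : List (LTLf P)) : LTLf P := l.foldr and tru

/-- A Boolean formula as a temporal formula, its propositions renamed along `f`. -/
def ofBool {P Q : Type*} (f : P → Q) : BoolFormula P → LTLf Q
  | .atom p => atom (f p)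
  | .neg φ => neg (ofBool f φ)
  | .and φ ψ => and (ofBool f φ) (ofBool f ψ)
  | .or φ ψ => or (ofBool f φ) (ofBool f ψ)

/-- `HoldsAt w i φ`: the formula `φ` is true on the finite word `w` at instant `i`
(meaningful for `i < w.length`). -/
def HoldsAt {P : Type*} (w : List (Finset P)) : ℕ → LTLf P → Prop
  | _, tru => True
  | i, atom p => ∃ a, w[i]? = some a ∧ p ∈ a
  | i, and φ ψ => HoldsAt w i φ ∧ HoldsAt w i ψ
  | i, neg φ => ¬ HoldsAt w i φ
  | i, next φ => i + 1 < w.length ∧ HoldsAt w (i + 1) φ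
  | i, untl φ ψ => ∃ j, i ≤ j ∧ j < w.length ∧ HoldsAt w j ψ ∧
      ∀ k, i ≤ k → k < j → HoldsAt w k φ

/-- A (nonempty) finite word satisfies a formula if the formula is true at its first instant. -/
def Satisfies {P : Type*} (w : List (Finset P)) (φ : LTLf P) : Prop := HoldsAt w 0 φ

end LTLf

/-! ## Dynamic domains and the mimicking problem -/

/-- A (serial) dynamic domain with states `S` over the propositions `P`; it is used only for
finite `S` and `P`. -/
structure Domain (S P : Type*) where
  init : S
  trans : Finset (S × S)
  label : S → Finset P
  serial : ∀ s, ∃ s', (s, s') ∈ trans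

namespace Domain

/-- Finite traces: nonempty state sequences that start in the initial state and follow the
transition relation. -/
def IsTrace {S P : Type*} (D : Domain S P) (τ : List S) : Prop :=
  τ.head? = some D.init ∧ τ.IsChain (fun s s' => (s, s') ∈ D.trans)

/-- Infinite traces. -/
def IsInfTrace {S P : Type*} (D : Domain S P) (τ : ℕ → S) : Prop :=
  τ 0 = D.init ∧ ∀ i, (τ i, τ (i + 1)) ∈ D.trans

/-- The size of an explicitly represented domain: number of states, of transitions and of
propositions. -/
def size {S P : Type*} [Fintype S] [Fintype P] (D : Domain S P) : ℕ :=
  Fintype.card S + D.trans.card + Fintype.card P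

end Domain

/-- The two agents. -/
inductive Agent where
  | A
  | B

/-- An instance of the problem Mimicking Behaviors in Separated Domains. The disjoint union of
the two sets of propositions is the sum type. -/
structure Problem (S T PA PB : Type*) where
  domA : Domain S PA
  domB : Domain T PB
  spec : LTLf (PA ⊕ PB)
  stopAgent : Agent

/-- The sequence `σ(s₀) σ(s₀s₁) ⋯ σ(s₀⋯sₙ)` induced by a strategy `σ` of agent `B` on
`s₀⋯sₙ`. A strategy maps nonempty state sequences to states; its value on the empty list is
never used. -/
def induced {S T : Type*} (σ : List S → T) (τ : List S) : List T :=
  (List.range τ.length).map fun i => σ (τ.take (i + 1))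

namespace Problem

variable {S T PA PB : Type*}

/-- The joint trace label of two traces of the same length. -/
def jointLabel (I : Problem S T PA PB) (τA : List S) (τB : List T) :
    List (Finset (PA ⊕ PB)) :=
  List.zipWith (fun s t => (I.domA.label s).disjSum (I.domB.label t)) τA τB

/-- Executable strategies. -/
def IsExecutable (I : Problem S T PA PB) (σ : List S → T) : Prop :=
  σ [I.domA.init] = I.domB.init ∧
    ∀ τ, I.domA.IsTrace τ → I.domB.IsTrace (induced σ τ)

/-- Strategies that are a solution of the problem instance. -/
def IsSolution (I : Problem S T PA PB) (σ : List S → T) : Prop :=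
  I.IsExecutable σ ∧
    match I.stopAgent with
    | .A => ∀ τ, I.domA.IsTrace τ → LTLf.Satisfies (I.jointLabel τ (induced σ τ)) I.spec
    | .B => ∀ τ : ℕ → S, I.domA.IsInfTrace τ → ∃ n : ℕ,
        LTLf.Satisfies (I.jointLabel ((List.range (n + 1)).map τ)
          (induced σ ((List.range (n + 1)).map τ))) I.spec

end Problem

/-! ## Two-player games with a safety objective -/

/-- The arena of a turn-based two-player game. -/
structure Arena (U V : Type*) where
  init : U
  move1 : U → V → Prop
  move2 : V → U → Prop

namespace Arena

variable {U V : Type*}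

/-- `PlayFrom u ρ`: starting in the node `u` of player 1, the list `ρ = (v₁,u₁)⋯(vₙ,uₙ)` of
rounds is a sequence of legal moves, i.e. `u v₁ u₁ ⋯ vₙ uₙ` is a path of the arena. -/
def PlayFrom (G : Arena U V) : U → List (V × U) → Prop
  | _, [] => True
  | u, (v, u') :: ρ => G.move1 u v ∧ G.move2 v u' ∧ PlayFrom G u' ρ

/-- The play `u₀ v₁ u₁ ⋯ vₙ uₙ`, given by its rounds `(vᵢ,uᵢ)`. -/
def IsPlay (G : Arena U V) (ρ : List (V × U)) : Prop := G.PlayFrom G.init ρ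

/-- The nodes `u₀ u₁ ⋯ uₙ` of player 1 in a play. -/
def nodes1 (G : Arena U V) (ρ : List (V × U)) : List U := G.init :: ρ.map Prod.snd

/-- In the play, player 2 always moves as the strategy `σ` says. -/
def Compatible (σ : List V → U) (ρ : List (V × U)) : Prop :=
  ρ.map Prod.snd = induced σ (ρ.map Prod.fst)

/-- The strategy `σ` of player 2 is winning for the safety objective `Safe(g)`: it always
prescribes legal moves, and in every play compatible with it all nodes of player 1 are in `g`. -/
def WinsSafe (G : Arena U V) (g : Set U) (σ : List V → U) : Prop :=
  ∀ ρ, G.IsPlay ρ → Compatible σ ρ →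
    (∀ u ∈ G.nodes1 ρ, u ∈ g) ∧
    ∀ u ∈ (G.nodes1 ρ).getLast?, ∀ v, G.move1 u v → G.move2 v (σ (ρ.map Prod.fst ++ [v]))

end Arena

/-! ## Point-wise mapping specifications -/

/-- Two domains together with the pairs `(φᵢ, ψᵢ)` of a point-wise mapping specification. -/
structure Pointwise (S T PA PB : Type*) where
  domA : Domain S PA
  domB : Domain T PB
  maps : List (BoolFormula PA × BoolFormula PB)

namespace Pointwise

variable {S T PA PB : Type*}

/-- The conjunction of the formulas `□ (φᵢ → ψᵢ)`. -/
def spec (I : Pointwise S T PA PB) : LTLf (PA ⊕ PB) :=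
  LTLf.conj (I.maps.map fun c =>
    LTLf.always (LTLf.imp (LTLf.ofBool Sum.inl c.1) (LTLf.ofBool Sum.inr c.2)))

/-- The problem instance with this mapping specification and with `A` as the stop agent. -/
def toProblem (I : Pointwise S T PA PB) : Problem S T PA PB where
  domA := I.domA
  domB := I.domB
  spec := I.spec
  stopAgent := .A

/-- `|D_A| + |D_B|`. -/
def domSize [Fintype S] [Fintype T] [Fintype PA] [Fintype PB] (I : Pointwise S T PA PB) : ℕ :=
  I.domA.size + I.domB.size

/-- The number of connectives of the conjunction of the `□ (φᵢ → ψᵢ)`. -/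
def mapSize (I : Pointwise S T PA PB) : ℕ :=
  (I.maps.map fun c => c.1.size + c.2.size + 2).sum + (I.maps.length - 1)

/-- The product arena: player 1 moves the first component along `D_A`, player 2 moves the
second component along `D_B`. -/
def arena (I : Pointwise S T PA PB) : Arena (S × T) (S × T) where
  init := (I.domA.init, I.domB.init)
  move1 u v := (u.1, v.1) ∈ I.domA.trans ∧ v.2 = u.2
  move2 v u := u.1 = v.1 ∧ (v.2, u.2) ∈ I.domB.trans

/-- The joint states in which all the implications `φᵢ → ψᵢ` are true. -/
def goal (I : Pointwise S T PA PB) : Set (S × T) :=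
  {u | ∀ c ∈ I.maps, c.1.Holds (I.domA.label u.1) → c.2.Holds (I.domB.label u.2)}

/-- The strategy of agent `B` given by a table `f`: it starts in the initial state and, when `A`
has moved to `s` and `B` is in `t`, moves to `f s t`. -/
def tableStrategy (I : Pointwise S T PA PB) (f : S → T → T) (τ : List S) : T :=
  τ.tail.foldl (fun t s => f s t) I.domB.init

end Pointwise

/-! ## Random access machines

Structured programs over finitely many natural-number registers and arrays, at unit cost. Addition
and truncated subtraction are the only arithmetic operations, so that numbers of more than
polynomially many bits cannot be built in polynomial time: the functions on bit strings computed
in polynomial time are those that Turing machines compute in polynomial time. -/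

/-- The contents of the registers and of the arrays. -/
structure Store where
  reg : ℕ → ℕ
  arr : ℕ → ℕ → ℕ

/-- Register `x` is set to `v`. -/
def Store.setReg (s : Store) (x v : ℕ) : Store where
  reg := Function.update s.reg x v
  arr := s.arr

/-- Entry `i` of array `a` is set to `v`. -/
def Store.setArr (s : Store) (a i v : ℕ) : Store where
  reg := s.reg
  arr := Function.update s.arr a (Function.update (s.arr a) i v)

/-- Expressions. -/
inductive Expr where
  | const (n : ℕ)
  | reg (x : ℕ)
  | read (a : ℕ) (e : Expr)
  | add (e e' : Expr)
  | sub (e e' : Expr)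

namespace Expr

/-- The value of an expression. -/
def eval (s : Store) : Expr → ℕ
  | const n => n
  | reg x => s.reg x
  | read a e => s.arr a (eval s e)
  | add e e' => eval s e + eval s e'
  | sub e e' => eval s e - eval s e'

/-- The number of operations in the evaluation of an expression. -/
def cost : Expr → ℕ
  | const _ => 1
  | reg _ => 1
  | read _ e => cost e + 1
  | add e e' => cost e + cost e' + 1
  | sub e e' => cost e + cost e' + 1

end Expr

/-- Programs: `assign x e` is `x := e`, `write a i e` is `a[i] := e`, and the tests of `ite` and
`loop` (a while loop) are whether the value of the expression is nonzero. -/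
inductive Program where
  | skip
  | assign (x : ℕ) (e : Expr)
  | write (a : ℕ) (i e : Expr)
  | seq (c d : Program)
  | ite (e : Expr) (c d : Program)
  | loop (e : Expr) (c : Program)

/-- `Exec c s s' n`: started in `s`, the program `c` halts in `s'` after `n` steps. -/
inductive Exec : Program → Store → Store → ℕ → Prop
  | skip (s : Store) : Exec .skip s s 1
  | assign (s : Store) (x : ℕ) (e : Expr) :
      Exec (.assign x e) s (s.setReg x (e.eval s)) (e.cost + 1)
  | write (s : Store) (a : ℕ) (i e : Expr) :
      Exec (.write a i e) s
        (s.setArr a (i.eval s) (e.eval s)) (i.cost + e.cost + 1)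
  | seq {c d : Program} {s s' s'' : Store} {m n : ℕ} :
      Exec c s s' m → Exec d s' s'' n → Exec (.seq c d) s s'' (m + n)
  | ite_true {e : Expr} {c d : Program} {s s' : Store} {n : ℕ} :
      e.eval s ≠ 0 → Exec c s s' n → Exec (.ite e c d) s s' (e.cost + 1 + n)
  | ite_false {e : Expr} {c d : Program} {s s' : Store} {n : ℕ} :
      e.eval s = 0 → Exec d s s' n → Exec (.ite e c d) s s' (e.cost + 1 + n)
  | loop_true {e : Expr} {c : Program} {s s' s'' : Store} {m n : ℕ} :
      e.eval s ≠ 0 → Exec c s s' m → Exec (.loop e c) s' s'' n →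
      Exec (.loop e c) s s'' (e.cost + 1 + m + n)
  | loop_false {e : Expr} {c : Program} {s : Store} :
      e.eval s = 0 → Exec (.loop e c) s s (e.cost + 1)

/-- The initial store: the input string in array `0`, its length in register `0`, and zeros
everywhere else. -/
def Store.ofInput (w : List Bool) : Store where
  reg x := if x = 0 then w.length else 0
  arr a i := if a = 0 then (w[i]?.getD false).toNat else 0

/-- The output string: it is in array `1`, its length in register `1`. -/
def Store.output (s : Store) : List Bool :=
  (List.range (s.reg 1)).map fun i => decide (s.arr 1 i ≠ 0)

/-- Started on the input string `w`, the program `c` halts within `n` steps with the output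
string `w'`. -/
def Computes (c : Program) (w w' : List Bool) (n : ℕ) : Prop :=
  ∃ s m, Exec c (Store.ofInput w) s m ∧ m ≤ n ∧ s.output = w'

/-! ## Problem instances and strategies as bit strings -/

/-- Each number `n` of the list is written as `n` ones followed by a zero. -/
def bits (l : List ℕ) : List Bool := l.flatMap fun n => List.replicate n true ++ [false]

/-- A formula in postfix notation, closed by `0`. -/
def BoolFormula.code {a : ℕ} (φ : BoolFormula (Fin a)) : List ℕ := go φ ++ [0]
where
  /-- Postfix notation. -/
  go : BoolFormula (Fin a) → List ℕ
    | .atom p => [p.val + 4]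
    | .neg φ => go φ ++ [1]
    | .and φ ψ => go φ ++ go ψ ++ [2]
    | .or φ ψ => go φ ++ go ψ ++ [3]

/-- A domain: the numbers of states and of propositions, the initial state, the adjacency matrix
and the table of labels. -/
def Domain.code {n a : ℕ} (D : Domain (Fin n) (Fin a)) : List ℕ :=
  [n, a, D.init.val] ++
    ((List.finRange n).flatMap fun s => (List.finRange n).map fun s' =>
      if (s, s') ∈ D.trans then 1 else 0) ++
    (List.finRange n).flatMap fun s => (List.finRange a).map fun p =>
      if p ∈ D.label s then 1 else 0

/-- The input string for an instance. -/
def Pointwise.input {n m a b : ℕ} (I : Pointwise (Fin n) (Fin m) (Fin a) (Fin b)) : List Bool :=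
  bits (I.domA.code ++ I.domB.code ++
    (I.maps.length :: I.maps.flatMap fun c => c.1.code ++ c.2.code))

/-- The table of a function `f`, row by row. -/
def tableCode {n m : ℕ} (f : Fin n → Fin m → Fin m) : List ℕ :=
  (List.finRange n).flatMap fun s => (List.finRange m).map fun t => (f s t).val

/-- Within `k` steps the program solves the instance: it answers `0` if the instance has no
solution, and otherwise `1` followed by the table of a strategy that is a solution. -/
def Pointwise.SolvedWithin {n m a b : ℕ} (I : Pointwise (Fin n) (Fin m) (Fin a) (Fin b))
    (c : Program) (k : ℕ) : Prop :=
  ((¬ ∃ σ, I.toProblem.IsSolution σ) ∧ Computes c I.input (bits [0]) k) ∨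
    ∃ f : Fin n → Fin m → Fin m, I.toProblem.IsSolution (I.tableStrategy f) ∧
      Computes c I.input (bits (1 :: tableCode f)) k

end MBSD

namespace MBSD

/-! ## Induced sequences and traces -/

section Induced

variable {S T : Type*}

/-! Both sides of the reduction say that a winning set exists (`IsWinSet`): a set of joint states
that contains the initial one, lies in the goal, and in which agent `B` can answer every move of `A`
without leaving it. A solution or a winning strategy yields such a set, namely the joint states that
it reaches. Conversely, choosing an answer inside the set for each joint state gives a memoryless
table, hence a solution (`IsWinSet.isSolution_tableStrategy`) and a winning strategy
(`IsWinSet.exists_winsSafe`). The translation rests on `isSolution_iff`: since traces are closed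
under nonempty prefixes, a solution need only be checked at the last state and the last transition
of each trace.

For the algorithm, `stay` removes the joint states in which `B` cannot answer some move within the
current set. Iterated from the goal it decreases, so it is stationary once the number of rounds
exceeds the number of joint states. The result is a winning set containing every other one, and a
solution exists exactly if the initial joint state is in it. The table takes the least answer in
each case.

The algorithm is written in a small language of terms and statements in which every sum and every
loop has the same length `N`, the length of the input. Polynomial running time then holds for every
statement, by structural induction on the compilation (`Tm.reaches_compile`, `St.reaches_compile`),
and correctness (`output_solveSt`) is proved on the denotational semantics alone. The adjacency
matrices make the input longer than the number of joint states (`mul_lt_length`), so a loop of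
length `N` covers all joint states and is long enough for the fixed point.

The input length is at most quadratic in the combined size (`length_input_le`), which gives the
combined bound. The other two bounds arise by replacing one summand of the combined size by the
constant `d`. -/

theorem induced_nil (σ : List S → T) : induced σ [] = [] := rfl

theorem length_induced (σ : List S → T) (τ : List S) : (induced σ τ).length = τ.length := by
  simp [induced]

theorem getElem_induced (σ : List S → T) (τ : List S) (j : ℕ) (h : j < (induced σ τ).length) :
    (induced σ τ)[j] = σ (τ.take (j + 1)) := by
  simp [induced]

/-- A strategy sees only prefixes, so extending the trace leaves the earlier answers unchanged. This
is what makes induction from the right end of a trace work. -/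
theorem induced_concat (σ : List S → T) (τ : List S) (s : S) :
    induced σ (τ ++ [s]) = induced σ τ ++ [σ (τ ++ [s])] := by
  unfold induced
  rw [List.length_append, List.length_singleton, List.range_succ, List.map_append]
  congr 1
  · apply List.map_congr_left
    intro i hi
    rw [List.mem_range] at hi
    rw [List.take_append_of_le_length (by omega)]
  · simp [List.take_of_length_le]

end Induced

namespace Domain

variable {S P : Type*}

theorem isTrace_singleton {D : Domain S P} {s : S} : D.IsTrace [s] ↔ s = D.init := by
  simp [IsTrace]

theorem isTrace_concat {D : Domain S P} {τ : List S} {s s' : S} :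
    D.IsTrace (τ ++ [s] ++ [s']) ↔ D.IsTrace (τ ++ [s]) ∧ (s, s') ∈ D.trans := by
  have h : (τ ++ [s] ++ [s']).head? = (τ ++ [s]).head? := by cases τ <;> simp
  rw [IsTrace, IsTrace, h, List.isChain_append]
  simp [and_assoc]

end Domain

/-! ## The meaning of point-wise mapping specifications -/

namespace LTLf

variable {P Q : Type*}

theorem holdsAt_always (w : List (Finset P)) (i : ℕ) (φ : LTLf P) :
    HoldsAt w i (always φ) ↔ ∀ j, i ≤ j → j < w.length → HoldsAt w j φ := by
  simp [always, eventually, HoldsAt]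

theorem holdsAt_imp (w : List (Finset P)) (i : ℕ) (φ ψ : LTLf P) :
    HoldsAt w i (imp φ ψ) ↔ (HoldsAt w i φ → HoldsAt w i ψ) := by
  simp [imp, HoldsAt]

theorem holdsAt_conj (w : List (Finset P)) (i : ℕ) (l : List (LTLf P)) :
    HoldsAt w i (conj l) ↔ ∀ φ ∈ l, HoldsAt w i φ := by
  induction l with
  | nil => simp [conj, HoldsAt]
  | cons φ l ih =>
    have : conj (φ :: l) = and φ (conj l) := rfl
    simp [this, HoldsAt, ih]

theorem holdsAt_ofBool (f : P → Q) (w : List (Finset Q)) (i : ℕ) (a : Finset P) (a' : Finset Q)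
    (hw : w[i]? = some a') (ha : ∀ p, f p ∈ a' ↔ p ∈ a) (φ : BoolFormula P) :
    HoldsAt w i (ofBool f φ) ↔ φ.Holds a := by
  induction φ with
  | atom p => simp [ofBool, HoldsAt, BoolFormula.Holds, hw, ha]
  | neg φ ih => simp [ofBool, HoldsAt, BoolFormula.Holds, ih]
  | and φ ψ ih ih' => simp [ofBool, HoldsAt, BoolFormula.Holds, ih, ih']
  | or φ ψ ih ih' => simp [ofBool, HoldsAt, BoolFormula.Holds, or, ih, ih']; tauto

end LTLf

namespace Pointwise

variable {S T PA PB : Type*} (I : Pointwise S T PA PB)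

/-- The "always" commutes with the conjunction, and the `j`-th letter is the disjoint union of the
labels of the `j`-th states, so each side of an implication sees only its own domain. -/
theorem satisfies_spec (σ : List S → T) (τ : List S) :
    LTLf.Satisfies (I.toProblem.jointLabel τ (induced σ τ)) I.spec ↔
      ∀ j (h : j < τ.length), (τ[j], σ (τ.take (j + 1))) ∈ I.goal := by
  have hlen : (I.toProblem.jointLabel τ (induced σ τ)).length = τ.length := by
    simp [Problem.jointLabel, length_induced]
  simp only [LTLf.Satisfies, spec, LTLf.holdsAt_conj, List.forall_mem_map, LTLf.holdsAt_always,
    LTLf.holdsAt_imp, hlen, goal, Set.mem_ofPred_eq, Nat.zero_le, true_implies]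
  have key : ∀ j (h : j < τ.length), (I.toProblem.jointLabel τ (induced σ τ))[j]? =
      some ((I.domA.label τ[j]).disjSum (I.domB.label (σ (τ.take (j + 1))))) := by
    intro j h
    rw [List.getElem?_eq_getElem (by omega)]
    simp [Problem.jointLabel, getElem_induced, toProblem]
  have hA := fun j h => LTLf.holdsAt_ofBool (Sum.inl : PA → PA ⊕ PB) _ j (I.domA.label τ[j]) _
    (key j h) (fun p => Finset.inl_mem_disjSum)
  have hB := fun j h => LTLf.holdsAt_ofBool (Sum.inr : PB → PA ⊕ PB) _ j
    (I.domB.label (σ (τ.take (j + 1)))) _ (key j h) (fun p => Finset.inr_mem_disjSum)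
  constructor
  · intro H j h c hc
    have := H c hc j h
    rwa [hA j h, hB j h] at this
  · intro H c hc j h
    rw [hA j h, hB j h]
    exact H j h c hc

/-- Nonempty prefixes of traces are traces, so a condition on all positions of all traces is a
condition on the last positions of all traces. -/
theorem isSolution_iff (σ : List S → T) :
    I.toProblem.IsSolution σ ↔ σ [I.domA.init] = I.domB.init ∧
      (∀ τ s, I.domA.IsTrace (τ ++ [s]) → (s, σ (τ ++ [s])) ∈ I.goal) ∧
      ∀ τ s s', I.domA.IsTrace (τ ++ [s] ++ [s']) →
        (σ (τ ++ [s]), σ (τ ++ [s] ++ [s'])) ∈ I.domB.trans := by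
  have hsat : I.toProblem.IsSolution σ ↔ I.toProblem.IsExecutable σ ∧
      ∀ τ, I.domA.IsTrace τ → ∀ j (h : j < τ.length), (τ[j], σ (τ.take (j + 1))) ∈ I.goal := by
    simp only [← satisfies_spec]
    rfl
  rw [hsat, Problem.IsExecutable]
  constructor
  · rintro ⟨⟨h0, hex⟩, hg⟩
    refine ⟨h0, fun τ s hτ => ?_, fun τ s s' hτ => ?_⟩
    · have := hg _ hτ τ.length (by simp)
      simpa [List.take_of_length_le] using this
    · have := hex _ hτ
      rw [induced_concat, induced_concat, Domain.isTrace_concat] at this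
      exact this.2
  · rintro ⟨h0, hg, hex⟩
    refine ⟨⟨h0, fun τ => ?_⟩, fun τ => ?_⟩
    · induction τ using List.reverseRecOn with
      | nil => exact fun h => by simp [Domain.IsTrace] at h
      | append_singleton τ s ih =>
        intro hτ
        rcases List.eq_nil_or_concat' τ with rfl | ⟨τ, s₁, rfl⟩
        · rw [List.nil_append] at hτ ⊢
          have hs : s = I.domA.init := Domain.isTrace_singleton.1 hτ
          rw [← List.nil_append [s], induced_concat, induced_nil, List.nil_append,
            Domain.isTrace_singleton, List.nil_append, hs]
          exact h0
        · have h1 := ih (Domain.isTrace_concat.1 hτ).1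
          rw [induced_concat] at h1
          rw [induced_concat, induced_concat, Domain.isTrace_concat]
          exact ⟨h1, hex _ _ _ hτ⟩
    · induction τ using List.reverseRecOn with
      | nil => exact fun _ j h => by simp at h
      | append_singleton τ s ih =>
        intro hτ j hj
        by_cases hjl : j < τ.length
        · have hτ' : I.domA.IsTrace τ := by
            rcases List.eq_nil_or_concat' τ with rfl | ⟨τ, s₁, rfl⟩
            · simp at hjl
            · exact (Domain.isTrace_concat.1 hτ).1
          have := ih hτ' j hjl
          rwa [List.getElem_append_left hjl, List.take_append_of_le_length (by omega)]
        · have hj' : j = τ.length := by simp at hj; omega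
          subst hj'
          have := hg τ s hτ
          simpa [List.take_of_length_le] using this

/-! ## Winning sets -/

/-- A set of joint states in the goal in which agent `B` can stay. -/
structure IsWinSet (W : Set (S × T)) : Prop where
  subset_goal : W ⊆ I.goal
  exists_response : ∀ s t, (s, t) ∈ W → ∀ s', (s, s') ∈ I.domA.trans →
    ∃ t', (t, t') ∈ I.domB.trans ∧ (s', t') ∈ W

/-- The table `f` keeps the joint state in `W`. -/
def KeepsIn (W : Set (S × T)) (f : S → T → T) : Prop :=
  ∀ s t, (s, t) ∈ W → ∀ s', (s, s') ∈ I.domA.trans →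
    (t, f s' t) ∈ I.domB.trans ∧ (s', f s' t) ∈ W

theorem IsWinSet.exists_keepsIn {W : Set (S × T)} (hW : I.IsWinSet W) : ∃ f, I.KeepsIn W f := by
  classical
  -- The default `t` is never inspected: `KeepsIn` speaks only of moves from `W`, where an answer
  -- exists.
  refine ⟨fun s' t => if h : ∃ t', (t, t') ∈ I.domB.trans ∧ (s', t') ∈ W then h.choose else t, ?_⟩
  intro s t hst s' hs'
  have h := hW.exists_response s t hst s' hs'
  simp only [dif_pos h]
  exact h.choose_spec

theorem tableStrategy_concat (f : S → T → T) (τ : List S) (s s' : S) :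
    I.tableStrategy f (τ ++ [s] ++ [s']) = f s' (I.tableStrategy f (τ ++ [s])) := by
  simp only [tableStrategy]
  rw [List.tail_append_of_ne_nil (by simp), List.foldl_append]
  rfl

/-- Along each trace the current joint state stays in `W`; safety and legality of the moves follow
from this invariant. -/
theorem IsWinSet.isSolution_tableStrategy {W : Set (S × T)} (hW : I.IsWinSet W)
    (h0 : (I.domA.init, I.domB.init) ∈ W) {f : S → T → T} (hf : I.KeepsIn W f) :
    I.toProblem.IsSolution (I.tableStrategy f) := by
  have key : ∀ τ s, I.domA.IsTrace (τ ++ [s]) → (s, I.tableStrategy f (τ ++ [s])) ∈ W := by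
    intro τ
    induction τ using List.reverseRecOn with
    | nil =>
      intro s hs
      have hs : s = I.domA.init := Domain.isTrace_singleton.1 hs
      subst hs
      exact h0
    | append_singleton τ s₁ ih =>
      intro s hs
      rw [Domain.isTrace_concat] at hs
      rw [tableStrategy_concat]
      exact (hf _ _ (ih s₁ hs.1) s hs.2).2
  rw [isSolution_iff]
  refine ⟨rfl, fun τ s h => hW.subset_goal (key τ s h), fun τ s s' h => ?_⟩
  rw [Domain.isTrace_concat] at h
  rw [tableStrategy_concat]
  exact (hf _ _ (key τ s h.1) s' h.2).1

/-- The joint states that `σ` reaches on traces form a winning set: any move of `A` extends the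
trace, and `σ` answers on the longer one. -/
theorem exists_isWinSet_of_isSolution {σ : List S → T} (hσ : I.toProblem.IsSolution σ) :
    ∃ W, I.IsWinSet W ∧ (I.domA.init, I.domB.init) ∈ W := by
  rw [isSolution_iff] at hσ
  obtain ⟨h0, hg, ht⟩ := hσ
  refine ⟨{u | ∃ τ, I.domA.IsTrace (τ ++ [u.1]) ∧ u.2 = σ (τ ++ [u.1])}, ⟨?_, ?_⟩, ?_⟩
  · rintro ⟨s, t⟩ ⟨τ, hτ, hu⟩
    simp only at hτ hu
    rw [hu]
    exact hg τ s hτ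
  · rintro s t ⟨τ, hτ, hu⟩ s' hs'
    simp only at hτ hu
    have h := Domain.isTrace_concat.2 ⟨hτ, hs'⟩
    refine ⟨σ (τ ++ [s] ++ [s']), ?_, τ ++ [s], h, rfl⟩
    rw [hu]
    exact ht τ s s' h
  · exact ⟨[], Domain.isTrace_singleton.2 rfl, h0.symm⟩

end Pointwise

/-! ## The safety game -/

namespace Arena

variable {U V : Type*} (G : Arena U V)

/-- The last node of a play. -/
def lastNode (u : U) (ρ : List (V × U)) : U := ((ρ.map Prod.snd).getLast?).getD u

theorem lastNode_concat (u : U) (ρ : List (V × U)) (v : V) (u' : U) :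
    lastNode u (ρ ++ [(v, u')]) = u' := by
  simp [lastNode]

theorem lastNode_cons (u : U) (ρ : List (V × U)) (v : V) (u' : U) :
    lastNode u ((v, u') :: ρ) = lastNode u' ρ := by
  simp [lastNode, List.getLast?_cons]

theorem playFrom_concat (u : U) (ρ : List (V × U)) (v : V) (u' : U) :
    G.PlayFrom u (ρ ++ [(v, u')]) ↔
      G.PlayFrom u ρ ∧ G.move1 (lastNode u ρ) v ∧ G.move2 v u' := by
  induction ρ generalizing u with
  | nil => simp [PlayFrom, lastNode]
  | cons r ρ ih =>
    obtain ⟨v₁, u₁⟩ := r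
    simp only [List.cons_append, PlayFrom, ih, lastNode_cons]
    tauto

theorem compatible_concat (σ : List V → U) (ρ : List (V × U)) (v : V) (u : U) :
    Compatible σ (ρ ++ [(v, u)]) ↔ Compatible σ ρ ∧ u = σ (ρ.map Prod.fst ++ [v]) := by
  simp only [Compatible, List.map_append, List.map_cons, List.map_nil, induced_concat]
  constructor
  · intro h
    have := List.append_inj' h rfl
    simpa using this
  · rintro ⟨h, rfl⟩
    rw [h]

theorem getLast?_nodes1 (ρ : List (V × U)) :
    (G.nodes1 ρ).getLast? = some (lastNode G.init ρ) := by
  simp [nodes1, lastNode, List.getLast?_cons]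

end Arena

namespace Pointwise

variable {S T PA PB : Type*} (I : Pointwise S T PA PB)

/-- The last nodes of the plays compatible with `σ` form a winning set, since a play can be
prolonged by any move of player 1 followed by the answer of `σ`. -/
theorem exists_isWinSet_of_winsSafe {σ : List (S × T) → S × T}
    (hσ : I.arena.WinsSafe I.goal σ) : ∃ W, I.IsWinSet W ∧ (I.domA.init, I.domB.init) ∈ W := by
  refine ⟨{u | ∃ ρ, I.arena.IsPlay ρ ∧ Arena.Compatible σ ρ ∧
    Arena.lastNode I.arena.init ρ = u}, ⟨?_, ?_⟩, ?_⟩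
  · rintro u ⟨ρ, hp, hc, rfl⟩
    exact (hσ ρ hp hc).1 _ (List.mem_of_getLast? (I.arena.getLast?_nodes1 ρ))
  · rintro s t ⟨ρ, hp, hc, hu⟩ s' hs'
    have hlast := I.arena.getLast?_nodes1 ρ
    rw [hu] at hlast
    have hm1 : I.arena.move1 (s, t) (s', t) := ⟨hs', rfl⟩
    have hm2 := (hσ ρ hp hc).2 (s, t) hlast (s', t) hm1
    set u' := σ (ρ.map Prod.fst ++ [(s', t)]) with hu'
    obtain ⟨h1, h2⟩ : u'.1 = s' ∧ (t, u'.2) ∈ I.domB.trans := id hm2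
    refine ⟨u'.2, h2, ρ ++ [((s', t), u')], ?_, ?_, ?_⟩
    · exact (I.arena.playFrom_concat _ _ _ _).2 ⟨hp, by rw [hu]; exact hm1, hm2⟩
    · exact (Arena.compatible_concat _ _ _ _).2 ⟨hc, hu'⟩
    · rw [Arena.lastNode_concat, ← h1]
  · exact ⟨[], trivial, rfl, rfl⟩

theorem IsWinSet.exists_winsSafe {W : Set (S × T)} (hW : I.IsWinSet W)
    (h0 : (I.domA.init, I.domB.init) ∈ W) : ∃ σ, I.arena.WinsSafe I.goal σ := by
  obtain ⟨f, hf⟩ := hW.exists_keepsIn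
  -- The last node records both the new state of `A` and the old state of `B`, so no history is
  -- needed. The default concerns only the empty list.
  let σ : List (S × T) → S × T := fun l =>
    (l.getLast?.map fun v => (v.1, f v.1 v.2)).getD I.arena.init
  have hσ : ∀ l v, σ (l ++ [v]) = (v.1, f v.1 v.2) := fun l v => by simp [σ]
  have hmove : ∀ u v, u ∈ W → I.arena.move1 u v → I.arena.move2 v (v.1, f v.1 v.2) ∧
      (v.1, f v.1 v.2) ∈ W := by
    rintro ⟨s, t⟩ ⟨s', t'⟩ hu ⟨h1, h2⟩
    simp only at h1 h2
    subst h2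
    have := hf s t' hu s' h1
    exact ⟨⟨rfl, this.1⟩, this.2⟩
  have key : ∀ ρ, I.arena.IsPlay ρ → Arena.Compatible σ ρ → ∀ u ∈ I.arena.nodes1 ρ, u ∈ W := by
    intro ρ
    induction ρ using List.reverseRecOn with
    | nil =>
      intro _ _ u hu
      simp only [Arena.nodes1, List.map_nil, List.mem_singleton] at hu
      rw [hu]
      exact h0
    | append_singleton ρ r ih =>
      obtain ⟨v, u'⟩ := r
      intro hp hc
      obtain ⟨hp, hm1, -⟩ := (I.arena.playFrom_concat _ _ _ _).1 hp
      obtain ⟨hc, hu'⟩ := (Arena.compatible_concat _ _ _ _).1 hc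
      have ih := ih hp hc
      intro u hu
      have hu : u ∈ I.arena.nodes1 ρ ∨ u = u' := by
        simp only [Arena.nodes1, List.map_append, List.map_cons, List.map_nil, List.mem_cons,
          List.mem_append, List.not_mem_nil, or_false] at hu ⊢
        tauto
      rcases hu with hu | rfl
      · exact ih u hu
      · rw [hu', hσ]
        exact (hmove _ v (ih _ (List.mem_of_getLast? (I.arena.getLast?_nodes1 ρ))) hm1).2
  refine ⟨σ, fun ρ hp hc => ⟨fun u hu => hW.subset_goal (key ρ hp hc u hu), ?_⟩⟩
  intro u hu v hm
  rw [hσ]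
  exact (hmove u v (key ρ hp hc u (List.mem_of_getLast? hu)) hm).1

theorem exists_isSolution_iff : (∃ σ, I.toProblem.IsSolution σ) ↔
    ∃ W, I.IsWinSet W ∧ (I.domA.init, I.domB.init) ∈ W := by
  constructor
  · rintro ⟨σ, hσ⟩
    exact I.exists_isWinSet_of_isSolution hσ
  · rintro ⟨W, hW, h0⟩
    obtain ⟨f, hf⟩ := hW.exists_keepsIn
    exact ⟨_, hW.isSolution_tableStrategy I h0 hf⟩

theorem exists_isSolution_iff_exists_winsSafe :
    (∃ σ, I.toProblem.IsSolution σ) ↔ ∃ σ, I.arena.WinsSafe I.goal σ := by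
  rw [exists_isSolution_iff]
  constructor
  · rintro ⟨W, hW, h0⟩
    exact hW.exists_winsSafe I h0
  · rintro ⟨σ, hσ⟩
    exact I.exists_isWinSet_of_winsSafe hσ

end Pointwise

/-! ## Terms with bounded sums -/

/-- The contents of the arrays. -/
abbrev Arrays := ℕ → ℕ → ℕ

/-- Terms over de Bruijn variables. All sums have the same range, and `call u a b c` is the value
of `u` in the environment given by the values of `a`, `b` and `c`. -/
inductive Tm where
  | const (n : ℕ)
  | var (i : ℕ)
  | read (a : ℕ) (u : Tm)
  | add (u v : Tm)
  | sub (u v : Tm)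
  | ite (u v w : Tm)
  | sum (u : Tm)
  | call (u a b c : Tm)

/-- The value of a term; `N` is the number of summands of sums. -/
def Tm.eval (N : ℕ) (A : Arrays) : List ℕ → Tm → ℕ
  | _, const n => n
  | ρ, var i => ρ.getD i 0
  | ρ, read a u => A a (u.eval N A ρ)
  | ρ, add u v => u.eval N A ρ + v.eval N A ρ
  | ρ, sub u v => u.eval N A ρ - v.eval N A ρ
  | ρ, ite u v w => if u.eval N A ρ ≠ 0 then v.eval N A ρ else w.eval N A ρ
  | ρ, sum u => ∑ i ∈ Finset.range N, u.eval N A (i :: ρ)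
  | ρ, call u a b c => u.eval N A [a.eval N A ρ, b.eval N A ρ, c.eval N A ρ]

/-- Statements over the same variables, acting on the arrays. All loops have the same length. -/
inductive St where
  | write (a : ℕ) (u v : Tm)
  | seq (c d : St)
  | ite (u : Tm) (c : St)
  | loop (c : St)

/-- The effect of a statement on the arrays. -/
def St.run (N : ℕ) : List ℕ → St → Arrays → Arrays
  | ρ, write a u v, A =>
      Function.update A a (Function.update (A a) (u.eval N A ρ) (v.eval N A ρ))
  | ρ, seq c d, A => d.run N ρ (c.run N ρ A)
  | ρ, ite u c, A => if u.eval N A ρ ≠ 0 then c.run N ρ A else A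
  | ρ, loop c, A => (List.range N).foldl (fun A i => c.run N (i :: ρ) A) A

/-! ## Compilation -/

/-- The loop of a program over the values of register `x` below the content of register `0`. -/
def Program.forLoop (x : ℕ) (c : Program) : Program :=
  .seq (.assign x (.const 0)) (.loop (.sub (.reg 0) (.reg x))
    (.seq c (.assign x (.add (.reg x) (.const 1)))))

/-- The program that computes a term into register `d`, given the registers of the variables. -/
def Tm.compile : List ℕ → ℕ → Tm → Program
  | _, d, const n => .assign d (.const n)
  | r, d, var i => .assign d (if h : i < r.length then .reg r[i] else .const 0)
  | r, d, read a u => .seq (u.compile r d) (.assign d (.read a (.reg d)))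
  | r, d, add u v => .seq (u.compile r d) (.seq (v.compile r (d + 1))
      (.assign d (.add (.reg d) (.reg (d + 1)))))
  | r, d, sub u v => .seq (u.compile r d) (.seq (v.compile r (d + 1))
      (.assign d (.sub (.reg d) (.reg (d + 1)))))
  | r, d, ite u v w => .seq (u.compile r d) (.ite (.reg d) (v.compile r d) (w.compile r d))
  | r, d, sum u => .seq (.assign d (.const 0)) (.forLoop (d + 1)
      (.seq (u.compile ((d + 1) :: r) (d + 2)) (.assign d (.add (.reg d) (.reg (d + 2))))))
  | r, d, call u a b c => .seq (a.compile r (d + 1)) (.seq (b.compile r (d + 2))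
      (.seq (c.compile r (d + 3)) (.seq (u.compile [d + 1, d + 2, d + 3] (d + 4))
        (.assign d (.reg (d + 4))))))

/-- The program of a statement; it changes only registers from `d` on. -/
def St.compile : List ℕ → ℕ → St → Program
  | r, d, write a u v => .seq (u.compile r d) (.seq (v.compile r (d + 1))
      (.write a (.reg d) (.reg (d + 1))))
  | r, d, seq c e => .seq (c.compile r d) (e.compile r d)
  | r, d, ite u c => .seq (u.compile r d) (.ite (.reg d) (c.compile r d) .skip)
  | r, d, loop c => .forLoop d (c.compile (d :: r) (d + 1))

/-- Started in `s`, the program halts within `k` steps in a store that satisfies `Q`. -/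
def Reaches (c : Program) (s : Store) (k : ℕ) (Q : Store → Prop) : Prop :=
  ∃ s' m, Exec c s s' m ∧ m ≤ k ∧ Q s'

theorem Reaches.mono {c : Program} {s : Store} {k k' : ℕ} {Q Q' : Store → Prop}
    (h : Reaches c s k Q) (hk : k ≤ k') (hQ : ∀ s', Q s' → Q' s') : Reaches c s k' Q' := by
  obtain ⟨s', m, he, hm, hq⟩ := h
  exact ⟨s', m, he, hm.trans hk, hQ s' hq⟩

theorem Reaches.seq {c d : Program} {s : Store} {k l : ℕ} {Q R : Store → Prop}
    (h : Reaches c s k Q) (h' : ∀ s', Q s' → Reaches d s' l R) :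
    Reaches (.seq c d) s (k + l) R := by
  obtain ⟨s', m, he, hm, hq⟩ := h
  obtain ⟨s'', m', he', hm', hr⟩ := h' s' hq
  exact ⟨s'', m + m', .seq he he', by omega, hr⟩

theorem Reaches.assign {s : Store} {x : ℕ} {e : Expr} {k : ℕ} {Q : Store → Prop}
    (hk : e.cost + 1 ≤ k) (h : Q (s.setReg x (e.eval s))) : Reaches (.assign x e) s k Q :=
  ⟨_, _, .assign s x e, hk, h⟩

theorem Reaches.ite {e : Expr} {c d : Program} {s : Store} {k : ℕ} {Q : Store → Prop}
    (hc : e.eval s ≠ 0 → Reaches c s k Q) (hd : e.eval s = 0 → Reaches d s k Q) :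
    Reaches (.ite e c d) s (e.cost + 1 + k) Q := by
  by_cases he : e.eval s = 0
  · obtain ⟨s', m, h, hm, hq⟩ := hd he
    exact ⟨s', _, .ite_false he h, by omega, hq⟩
  · obtain ⟨s', m, h, hm, hq⟩ := hc he
    exact ⟨s', _, .ite_true he h, by omega, hq⟩

/-- `Q i` is the invariant when the counter is `i`. The test `N - i` is nonzero exactly for `i < N`,
provided that the body preserves the counter and register `0`. A round costs `k`, plus 4 for the
test and 4 for the increment; the final 6 pays for the initialization and the failing test. -/
theorem Reaches.forLoop {x N k : ℕ} {c : Program} {s : Store} (Q : ℕ → Store → Prop)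
    (hQ0 : Q 0 (s.setReg x 0))
    (hN : ∀ i s, Q i s → s.reg 0 = N)
    (hstep : ∀ i s, i < N → s.reg x = i → Q i s →
      Reaches c s k (fun s' => s'.reg x = i ∧ Q (i + 1) (s'.setReg x (i + 1)))) :
    Reaches (Program.forLoop x c) s (N * (k + 8) + 6) (Q N) := by
  -- Here `j` is the number of rounds still to come.
  have main : ∀ j i s, i + j = N → s.reg x = i → Q i s →
      Reaches (.loop (.sub (.reg 0) (.reg x)) (.seq c (.assign x (.add (.reg x) (.const 1)))))
        s (j * (k + 8) + 4) (Q N) := by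
    intro j
    induction j with
    | zero =>
      intro i s hi hs hq
      obtain rfl : i = N := by omega
      exact ⟨s, _, .loop_false (by simp [Expr.eval, hs, hN _ _ hq]), by simp [Expr.cost], hq⟩
    | succ j ih =>
      intro i s hi hs hq
      have h1 : Reaches (.seq c (.assign x (.add (.reg x) (.const 1)))) s (k + 4)
          (fun s' => s'.reg x = i + 1 ∧ Q (i + 1) s') := by
        refine (hstep i s (by omega) hs hq).seq fun s' hs' => Reaches.assign (by simp [Expr.cost]) ?_
        simp only [Expr.eval, hs'.1]
        exact ⟨by simp [Store.setReg], hs'.2⟩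
      obtain ⟨s', m, he, hm, hx', hq'⟩ := h1
      obtain ⟨s'', m', he', hm', hq''⟩ := ih (i + 1) s' (by omega) hx' hq'
      refine ⟨s'', _, .loop_true ?_ he he', ?_, hq''⟩
      · simp only [Expr.eval, hs, hN _ _ hq]
        omega
      · simp only [Expr.cost]
        rw [add_mul]
        omega
  refine ((Reaches.assign (k := 2) (Q := fun s' => s'.reg x = 0 ∧ Q 0 s') (by simp [Expr.cost])
    ?_).seq fun s' hs' => main N 0 s' (by omega) hs'.1 hs'.2).mono (by omega) fun _ h => h
  exact ⟨by simp [Store.setReg, Expr.eval], hQ0⟩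

/-- `s` and `s'` have the same registers below `d`. -/
def AgreeBelow (d : ℕ) (s s' : Store) : Prop := ∀ x < d, s'.reg x = s.reg x

theorem AgreeBelow.refl (d : ℕ) (s : Store) : AgreeBelow d s s := fun _ _ => rfl

theorem AgreeBelow.trans {d : ℕ} {s s' s'' : Store} (h : AgreeBelow d s s')
    (h' : AgreeBelow d s' s'') : AgreeBelow d s s'' :=
  fun x hx => (h' x hx).trans (h x hx)

theorem AgreeBelow.mono {d d' : ℕ} {s s' : Store} (h : AgreeBelow d s s') (hd : d' ≤ d) :
    AgreeBelow d' s s' := fun x hx => h x (by omega)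

theorem AgreeBelow.setReg {d : ℕ} {s s' : Store} (h : AgreeBelow d s s') {x : ℕ} (hx : d ≤ x)
    (v : ℕ) : AgreeBelow d s (s'.setReg x v) := fun y hy => by
  rw [← h y hy]
  exact Function.update_of_ne (by omega) _ _

theorem AgreeBelow.map_eq {d : ℕ} {s s' : Store} (h : AgreeBelow d s s') {r : List ℕ}
    (hr : ∀ x ∈ r, x < d) : r.map s'.reg = r.map s.reg :=
  List.map_congr_left fun x hx => h x (hr x hx)

theorem setReg_reg_self (s : Store) (x v : ℕ) : (s.setReg x v).reg x = v := by simp [Store.setReg]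

theorem setReg_reg_of_ne (s : Store) {x y : ℕ} (h : y ≠ x) (v : ℕ) :
    (s.setReg x v).reg y = s.reg y := by simp [Store.setReg, h]

theorem setReg_arr (s : Store) (x v : ℕ) : (s.setReg x v).arr = s.arr := rfl

/-- Registers are used as a stack: everything below `d` is preserved, in particular the variables
and, as `0 < d`, the loop length in register `0`. Hence the bounds of successive subterms refer to
the same number and can be added, and a sum multiplies the bound by it. The polynomial is chosen
before the store. -/
theorem Tm.reaches_compile (u : Tm) : ∀ (r : List ℕ) (d : ℕ), 0 < d → (∀ x ∈ r, x < d) →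
    ∃ p : Polynomial ℕ, ∀ s : Store, Reaches (u.compile r d) s (p.eval (s.reg 0)) fun s' =>
      s'.arr = s.arr ∧ AgreeBelow d s s' ∧
        s'.reg d = u.eval (s.reg 0) s.arr (r.map s.reg) := by
  induction u with
  | const n =>
    intro r d hd hr
    refine ⟨2, fun s => Reaches.assign (by simp [Expr.cost])
      ⟨rfl, (AgreeBelow.refl d s).setReg le_rfl _, ?_⟩⟩
    simp [setReg_reg_self, Expr.eval, eval]
  | var i =>
    intro r d hd hr
    refine ⟨2, fun s => Reaches.assign ?_ ⟨rfl, (AgreeBelow.refl d s).setReg le_rfl _, ?_⟩⟩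
    · split_ifs <;> simp [Expr.cost]
    · rw [setReg_reg_self]
      by_cases h : i < r.length
      · simp [h, Expr.eval, eval]
      · simp [h, Expr.eval, eval]
  | read a u ih =>
    intro r d hd hr
    obtain ⟨p, hp⟩ := ih r d hd hr
    refine ⟨p + 3, fun s => ?_⟩
    rw [Polynomial.eval_add]
    refine (hp s).seq fun s' ⟨h1, h2, h3⟩ => Reaches.assign (by simp [Expr.cost])
      ⟨h1, h2.setReg le_rfl _, ?_⟩
    simp [setReg_reg_self, Expr.eval, eval, h3, h1]
  | add u v ih ih' =>
    intro r d hd hr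
    obtain ⟨p, hp⟩ := ih r d hd hr
    obtain ⟨q, hq⟩ := ih' r (d + 1) (by omega) fun x hx => by have := hr x hx; omega
    refine ⟨p + (q + 4), fun s => ?_⟩
    rw [Polynomial.eval_add, Polynomial.eval_add]
    refine (hp s).seq fun s' ⟨h1, h2, h3⟩ => ?_
    rw [← h2 0 hd]
    refine (hq s').seq fun s'' ⟨h4, h5, h6⟩ => Reaches.assign (by simp [Expr.cost])
      ⟨h4.trans h1, (h2.trans (h5.mono (by omega))).setReg le_rfl _, ?_⟩
    simp [setReg_reg_self, Expr.eval, eval, h6, h5 d (by omega), h3, h1, h2 0 hd]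
    exact congrArg (fun ρ => Tm.eval _ _ ρ v) (h2.map_eq hr)
  | sub u v ih ih' =>
    intro r d hd hr
    obtain ⟨p, hp⟩ := ih r d hd hr
    obtain ⟨q, hq⟩ := ih' r (d + 1) (by omega) fun x hx => by have := hr x hx; omega
    refine ⟨p + (q + 4), fun s => ?_⟩
    rw [Polynomial.eval_add, Polynomial.eval_add]
    refine (hp s).seq fun s' ⟨h1, h2, h3⟩ => ?_
    rw [← h2 0 hd]
    refine (hq s').seq fun s'' ⟨h4, h5, h6⟩ => Reaches.assign (by simp [Expr.cost])
      ⟨h4.trans h1, (h2.trans (h5.mono (by omega))).setReg le_rfl _, ?_⟩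
    simp only [setReg_reg_self, Expr.eval, eval, h6, h5 d (by omega), h3, h1, h2 0 hd,
      h2.map_eq hr]
  | ite u v w ih ih' ih'' =>
    intro r d hd hr
    obtain ⟨p, hp⟩ := ih r d hd hr
    obtain ⟨q, hq⟩ := ih' r d hd hr
    obtain ⟨q', hq'⟩ := ih'' r d hd hr
    refine ⟨p + (2 + (q + q')), fun s => ?_⟩
    simp only [Polynomial.eval_add]
    refine (hp s).seq fun s' ⟨h1, h2, h3⟩ => ?_
    rw [← h2 0 hd]
    -- The sum of the two bounds serves whichever branch is taken.
    refine (Reaches.ite (fun he => (hq s').mono (k' := q.eval (s'.reg 0) + q'.eval (s'.reg 0))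
      (by omega) ?_) (fun he => (hq' s').mono (by omega) ?_)).mono (by simp [Expr.cost]) fun _ h => h
    all_goals
      rintro s'' ⟨h4, h5, h6⟩
      simp only [Expr.eval, h3] at he
      refine ⟨h4.trans h1, h2.trans h5, ?_⟩
      simp [h6, eval, he, h1, h2 0 hd]
      exact congrArg (fun ρ => Tm.eval _ _ ρ _) (h2.map_eq hr)
  | sum u ih =>
    intro r d hd hr
    obtain ⟨p, hp⟩ := ih ((d + 1) :: r) (d + 2) (by omega) fun x hx => by
      rcases List.mem_cons.1 hx with rfl | hx
      · omega
      · have := hr x hx; omega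
    -- 12 is the overhead 8 of a round of `forLoop` plus 4 for adding the summand to register `d`.
    refine ⟨2 + (Polynomial.X * (p + 12) + 6), fun s => ?_⟩
    rw [Polynomial.eval_add]
    refine (Reaches.assign (Q := fun s' => s' = s.setReg d 0) (by simp [Expr.cost]) rfl).seq
      fun s' hs' => ?_
    subst hs'
    -- Register `d` holds the partial sum, `d + 1` the counter and `d + 2` the current summand.
    refine (Reaches.forLoop (N := s.reg 0) (k := p.eval (s.reg 0) + 4) (fun i s' =>
      s'.arr = s.arr ∧ AgreeBelow d s s' ∧
        s'.reg d = ∑ j ∈ Finset.range i, u.eval (s.reg 0) s.arr (j :: r.map s.reg)) ?_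
      ?_ ?_).mono (by simp [add_assoc]) ?_
    · refine ⟨rfl, ((AgreeBelow.refl d s).setReg le_rfl _).setReg (by omega) _, ?_⟩
      rw [setReg_reg_of_ne _ (by omega), setReg_reg_self, Finset.sum_range_zero]
    · exact fun i s' h => h.2.1 0 hd
    · rintro i s' hi hxi ⟨h1, h2, h3⟩
      rw [← h2 0 hd]
      refine (hp s').seq fun s'' ⟨h4, h5, h6⟩ => Reaches.assign (by simp [Expr.cost]) ⟨?_, ?_, ?_, ?_⟩
      · rw [setReg_reg_of_ne _ (by omega), h5 _ (by omega), hxi]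
      · exact h4.trans h1
      · exact ((h2.trans (h5.mono (by omega))).setReg le_rfl _).setReg (by omega) _
      · rw [setReg_reg_of_ne _ (by omega), setReg_reg_self]
        simp only [Expr.eval, h5 d (by omega), h3, h6, List.map_cons, hxi, h1, h2 0 hd,
          h2.map_eq hr, Finset.sum_range_succ]
    · exact fun s' h => h
  | call u a b c ihu iha ihb ihc =>
    intro r d hd hr
    have hr' : ∀ e, ∀ x ∈ r, x < d + e := fun e x hx => by have := hr x hx; omega
    obtain ⟨pa, ha⟩ := iha r (d + 1) (by omega) (hr' 1)
    obtain ⟨pb, hb⟩ := ihb r (d + 2) (by omega) (hr' 2)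
    obtain ⟨pc, hc⟩ := ihc r (d + 3) (by omega) (hr' 3)
    obtain ⟨pu, hu⟩ := ihu [d + 1, d + 2, d + 3] (d + 4) (by omega) (by simp)
    refine ⟨pa + (pb + (pc + (pu + 2))), fun s => ?_⟩
    simp only [Polynomial.eval_add]
    refine (ha s).seq fun s₁ ⟨a1, a2, a3⟩ => ?_
    rw [← a2 0 (by omega)]
    refine (hb s₁).seq fun s₂ ⟨b1, b2, b3⟩ => ?_
    rw [← b2 0 (by omega)]
    refine (hc s₂).seq fun s₃ ⟨c1, c2, c3⟩ => ?_
    rw [← c2 0 (by omega)]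
    refine (hu s₃).seq fun s₄ ⟨u1, u2, u3⟩ => Reaches.assign (by simp [Expr.cost]) ⟨?_, ?_, ?_⟩
    · exact u1.trans (c1.trans (b1.trans a1))
    · exact ((((a2.mono (by omega)).trans (b2.mono (by omega))).trans (c2.mono (by omega))).trans
        (u2.mono (by omega))).setReg le_rfl _
    · rw [setReg_reg_self]
      have ea := a2.map_eq (hr' 1)
      have eb := b2.map_eq (hr' 2)
      simp only [Expr.eval, u3, List.map_cons, List.map_nil, c3, c2 (d + 2) (by omega), b3,
        c2 (d + 1) (by omega), b2 (d + 1) (by omega), a3, c1, b1, a1, c2 0 (by omega),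
        b2 0 (by omega), a2 0 (by omega), eb, ea, eval]

/-- As for terms; a loop counter sits in register `d` and becomes the innermost variable of the
body, which works from `d + 1` on. -/
theorem St.reaches_compile (c : St) : ∀ (r : List ℕ) (d : ℕ), 0 < d → (∀ x ∈ r, x < d) →
    ∃ p : Polynomial ℕ, ∀ s : Store, Reaches (c.compile r d) s (p.eval (s.reg 0)) fun s' =>
      s'.arr = c.run (s.reg 0) (r.map s.reg) s.arr ∧ AgreeBelow d s s' := by
  induction c with
  | write a u v =>
    intro r d hd hr
    obtain ⟨p, hp⟩ := u.reaches_compile r d hd hr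
    obtain ⟨q, hq⟩ := v.reaches_compile r (d + 1) (by omega) fun x hx => by
      have := hr x hx; omega
    refine ⟨p + (q + 3), fun s => ?_⟩
    rw [Polynomial.eval_add, Polynomial.eval_add]
    refine (hp s).seq fun s' ⟨h1, h2, h3⟩ => ?_
    rw [← h2 0 hd]
    refine (hq s').seq fun s'' ⟨h4, h5, h6⟩ => ⟨_, _, .write s'' a _ _, by simp [Expr.cost], ?_, ?_⟩
    · simp only [Store.setArr, Expr.eval, h4, h1, h5 d (by omega), h3, h6, h2 0 hd,
        h2.map_eq hr, run]
    · exact h2.trans (h5.mono (by omega))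
  | seq c e ih ih' =>
    intro r d hd hr
    obtain ⟨p, hp⟩ := ih r d hd hr
    obtain ⟨q, hq⟩ := ih' r d hd hr
    refine ⟨p + q, fun s => ?_⟩
    rw [Polynomial.eval_add]
    refine (hp s).seq fun s' ⟨h1, h2⟩ => ?_
    rw [← h2 0 hd]
    refine (hq s').mono le_rfl fun s'' ⟨h3, h4⟩ => ⟨?_, h2.trans h4⟩
    rw [h3, h1, h2 0 hd, h2.map_eq hr, run]
  | ite u c ih =>
    intro r d hd hr
    obtain ⟨p, hp⟩ := u.reaches_compile r d hd hr
    obtain ⟨q, hq⟩ := ih r d hd hr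
    refine ⟨p + (2 + (q + 1)), fun s => ?_⟩
    simp only [Polynomial.eval_add]
    refine (hp s).seq fun s' ⟨h1, h2, h3⟩ => ?_
    rw [← h2 0 hd]
    refine (Reaches.ite (k := q.eval (s'.reg 0) + 1) (fun he => (hq s').mono (by omega) ?_)
      (fun he => ⟨s', 1, .skip s', by omega, ?_⟩)).mono (by simp [Expr.cost]) fun _ h => h
    · rintro s'' ⟨h4, h5⟩
      simp only [Expr.eval, h3] at he
      refine ⟨?_, h2.trans h5⟩
      rw [h4, h1, h2 0 hd, h2.map_eq hr, run, if_pos he]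
    · simp only [Expr.eval, h3] at he
      exact ⟨by rw [run, h2 0 hd, if_neg (not_not.2 he), h1], h2⟩
  | loop c ih =>
    intro r d hd hr
    obtain ⟨p, hp⟩ := ih (d :: r) (d + 1) (by omega) fun x hx => by
      rcases List.mem_cons.1 hx with rfl | hx
      · omega
      · have := hr x hx; omega
    refine ⟨Polynomial.X * (p + 8) + 6, fun s => ?_⟩
    refine (Reaches.forLoop (N := s.reg 0) (k := p.eval (s.reg 0)) (fun i s' =>
      s'.arr = (List.range i).foldl (fun A i => c.run (s.reg 0) (i :: r.map s.reg) A) s.arr ∧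
        AgreeBelow d s s') ?_ ?_ ?_).mono (by simp) ?_
    · exact ⟨rfl, (AgreeBelow.refl d s).setReg le_rfl _⟩
    · exact fun i s' h => h.2 0 hd
    · rintro i s' hi hxi ⟨h1, h2⟩
      rw [← h2 0 hd]
      refine (hp s').mono le_rfl fun s'' ⟨h3, h4⟩ => ⟨?_, ?_, ?_⟩
      · rw [h4 d (by omega), hxi]
      · rw [setReg_arr, h3, List.map_cons, hxi, h2.map_eq hr, h2 0 hd, List.range_succ,
          List.foldl_append, h1]
        rfl
      · exact (h2.trans (h4.mono (by omega))).setReg le_rfl _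
    · exact fun s' h => h

/-! ## Statements as programs on bit strings -/

/-- The program of a statement that leaves the length of its output in entry `0` of array `9`. -/
def St.program (c : St) : Program := .seq (c.compile [] 2) (.assign 1 (.read 9 (.const 0)))

/-- The output of a statement on an input string. -/
def St.output (c : St) (w : List Bool) : List Bool :=
  let A := c.run w.length [] (Store.ofInput w).arr
  (List.range (A 9 0)).map fun i => decide (A 1 i ≠ 0)

/-- Register `0` initially contains the length of the input, so this is the common length of all
loops. -/
theorem St.computes_program (c : St) : ∃ p : Polynomial ℕ, ∀ w : List Bool,
    Computes c.program w (c.output w) (p.eval w.length) := by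
  obtain ⟨p, hp⟩ := c.reaches_compile [] 2 (by omega) (by simp)
  refine ⟨p + 3, fun w => ?_⟩
  have h0 : (Store.ofInput w).reg 0 = w.length := rfl
  have h := hp (Store.ofInput w)
  rw [h0] at h
  obtain ⟨s, m, he, hm, hQ⟩ := h.seq fun s' hs' =>
    Reaches.assign (x := 1) (e := .read 9 (.const 0)) (k := 3)
      (Q := fun s => s.arr = c.run w.length [] (Store.ofInput w).arr ∧ s.reg 1 = s.arr 9 0)
      (by simp [Expr.cost]) ⟨hs'.1, by simp [setReg_reg_self, Expr.eval, setReg_arr]⟩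
  refine ⟨s, m, he, by simpa using hm, ?_⟩
  rw [Store.output, hQ.2, hQ.1]
  rfl

/-! ## Derived terms -/

namespace Tm

/-- `u < v`. -/
def lt (u v : Tm) : Tm := sub v u

/-- Negation of a truth value. -/
def not (u : Tm) : Tm := ite u (const 0) (const 1)

/-- Conjunction of truth values. -/
def and (u v : Tm) : Tm := ite u v (const 0)

/-- `u = v`. -/
def eq (u v : Tm) : Tm := not (add (sub u v) (sub v u))

/-- Existential quantification over the numbers below the common loop length. -/
def ex (u : Tm) : Tm := sum (ite u (const 1) (const 0))

/-- The product. -/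
def mul (u v : Tm) : Tm :=
  call (sum (ite (lt (var 0) (var 1)) (var 2) (const 0))) u v (const 0)

/-- The integer quotient. -/
def div (u v : Tm) : Tm :=
  call (sum (not (lt (var 1) (mul (add (var 0) (const 1)) (var 2))))) u v (const 0)

/-- The remainder. -/
def mod (u v : Tm) : Tm := sub u (mul (div u v) v)

variable {N : ℕ} {A : Arrays} {ρ : List ℕ} {u v : Tm}

theorem eval_lt_ne_zero : (lt u v).eval N A ρ ≠ 0 ↔ u.eval N A ρ < v.eval N A ρ := by
  simp only [lt, eval]; omega

theorem eval_not_ne_zero : (not u).eval N A ρ ≠ 0 ↔ ¬ u.eval N A ρ ≠ 0 := by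
  simp only [not, eval]; split_ifs with h <;> simp [h]

theorem eval_and_ne_zero :
    (and u v).eval N A ρ ≠ 0 ↔ u.eval N A ρ ≠ 0 ∧ v.eval N A ρ ≠ 0 := by
  simp only [and, eval]; split_ifs with h <;> simp [h]

theorem eval_ex_ne_zero : (ex u).eval N A ρ ≠ 0 ↔ ∃ i < N, u.eval N A (i :: ρ) ≠ 0 := by
  simp [ex, eval]

/-- Of the `N` summands, those with index below the first factor equal the second factor and the
others vanish; the bound ensures that there are enough summands. Passing the factors through `call`
avoids shifting their variables under the sum. -/
theorem eval_mul (h : u.eval N A ρ ≤ N) :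
    (mul u v).eval N A ρ = u.eval N A ρ * v.eval N A ρ := by
  have : (mul u v).eval N A ρ =
      ∑ i ∈ Finset.range N, if i < u.eval N A ρ then v.eval N A ρ else 0 := by
    simp only [mul, eval, eval_lt_ne_zero]
    rfl
  have hf : (Finset.range N).filter (fun i => i < u.eval N A ρ) =
      Finset.range (u.eval N A ρ) := by
    ext i; simp; omega
  rw [this, ← Finset.sum_filter, hf]
  simp

/-- The quotient counts the `i` for which `i + 1` times the divisor does not exceed the dividend. -/
theorem eval_div (h : u.eval N A ρ < N) (hv : 0 < v.eval N A ρ) :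
    (div u v).eval N A ρ = u.eval N A ρ / v.eval N A ρ := by
  have : (div u v).eval N A ρ =
      ∑ i ∈ Finset.range N, if i < u.eval N A ρ / v.eval N A ρ then 1 else 0 := by
    simp only [div, eval]
    refine Finset.sum_congr rfl fun i hi => ?_
    rw [Finset.mem_range] at hi
    have hl : (lt (var 1) (mul (add (var 0) (const 1)) (var 2))).eval N A
        [i, u.eval N A ρ, v.eval N A ρ, 0] ≠ 0 ↔ ¬ i < u.eval N A ρ / v.eval N A ρ := by
      rw [eval_lt_ne_zero, eval_mul (by simp [eval]; omega), not_lt, ← Nat.lt_succ_iff,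
        Nat.div_lt_iff_lt_mul hv]
      rfl
    rw [not, eval]
    by_cases hc : i < u.eval N A ρ / v.eval N A ρ
    · rw [if_neg (by rw [hl]; simpa using hc), if_pos hc]
      rfl
    · rw [if_pos (hl.2 hc), if_neg hc]
      rfl
  have hf : (Finset.range N).filter (fun i => i < u.eval N A ρ / v.eval N A ρ) =
      Finset.range (u.eval N A ρ / v.eval N A ρ) := by
    have := Nat.div_le_self (u.eval N A ρ) (v.eval N A ρ)
    ext i; simp; omega
  rw [this, ← Finset.sum_filter, hf]
  simp

theorem eval_mod (h : u.eval N A ρ < N) (hv : 0 < v.eval N A ρ) :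
    (mod u v).eval N A ρ = u.eval N A ρ % v.eval N A ρ := by
  have := Nat.div_le_self (u.eval N A ρ) (v.eval N A ρ)
  have hd := eval_div h hv
  rw [mod, eval, eval_mul (by omega), hd, Nat.mod_eq_sub, mul_comm]

/-- The arrays read by a term. -/
def reads : Tm → List ℕ
  | const _ => []
  | var _ => []
  | read a u => a :: u.reads
  | add u v => u.reads ++ v.reads
  | sub u v => u.reads ++ v.reads
  | ite u v w => u.reads ++ v.reads ++ w.reads
  | sum u => u.reads
  | call u a b c => u.reads ++ a.reads ++ b.reads ++ c.reads

theorem eval_congr {A' : Arrays} (ρ : List ℕ) (h : ∀ a ∈ u.reads, A' a = A a) :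
    u.eval N A' ρ = u.eval N A ρ := by
  induction u generalizing ρ with
  | const n => rfl
  | var i => rfl
  | read a u ih =>
    simp only [reads, List.mem_cons, forall_eq_or_imp] at h
    rw [eval, eval, h.1, ih ρ h.2]
  | add u v ih ih' | sub u v ih ih' =>
    simp only [reads, List.forall_mem_append] at h
    rw [eval, eval, ih ρ h.1, ih' ρ h.2]
  | ite u v w ih ih' ih'' =>
    simp only [reads, List.forall_mem_append] at h
    rw [eval, eval, ih ρ h.1.1, ih' ρ h.1.2, ih'' ρ h.2]
  | sum u ih => exact Finset.sum_congr rfl fun i _ => ih _ h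
  | call u a b c ihu iha ihb ihc =>
    simp only [reads, List.forall_mem_append] at h
    rw [eval, eval, iha ρ h.1.1.2, ihb ρ h.1.2, ihc ρ h.2, ihu _ h.1.1.1]

end Tm

/-! ## Frames and loop invariants -/

namespace St

/-- The arrays to which a statement writes. -/
def targets : St → List ℕ
  | write a _ _ => [a]
  | seq c d => c.targets ++ d.targets
  | ite _ c => c.targets
  | loop c => c.targets

theorem run_of_notMem_targets {N : ℕ} {c : St} {a : ℕ} (h : a ∉ c.targets) (ρ : List ℕ)
    (A : Arrays) : c.run N ρ A a = A a := by
  induction c generalizing ρ A with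
  | write b u v => exact Function.update_of_ne (by simpa [targets] using h) _ _
  | seq c d ih ih' =>
    simp only [targets, List.mem_append, not_or] at h
    rw [run, ih' h.2, ih h.1]
  | ite u c ih =>
    rw [run]
    split_ifs
    · exact ih h ρ A
    · rfl
  | loop c ih =>
    rw [run]
    generalize List.range N = l
    induction l generalizing A with
    | nil => rfl
    | cons i l ih' => rw [List.foldl_cons, ih', ih h]

/-- All loops of the algorithm are verified by this invariant rule, usually together with the frame
rule `run_of_notMem_targets`. -/
theorem run_loop_induction {N : ℕ} {c : St} {ρ : List ℕ} {A : Arrays} (P : ℕ → Arrays → Prop)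
    (h0 : P 0 A) (hstep : ∀ i A, i < N → P i A → P (i + 1) (c.run N (i :: ρ) A)) :
    P N ((loop c).run N ρ A) := by
  have : ∀ j ≤ N, P j ((List.range j).foldl (fun A i => c.run N (i :: ρ) A) A) := by
    intro j
    induction j with
    | zero => exact fun _ => h0
    | succ j ih =>
      intro hj
      rw [List.range_succ, List.foldl_append]
      exact hstep j _ (by omega) (ih (by omega))
  exact this N le_rfl

/-- Array `a` is filled with the values of a term. -/
def fill (a : ℕ) (u : Tm) : St := loop (write a (.var 0) u)

/-- Each entry is computed in the partly overwritten arrays, but `u` does not read the array being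
filled, so its value is the one in `A`. -/
theorem run_fill {N : ℕ} {a : ℕ} {u : Tm} {ρ : List ℕ} {A : Arrays}
    (hu : a ∉ u.reads) {i : ℕ} (hi : i < N) : (fill a u).run N ρ A a i = u.eval N A (i :: ρ) := by
  refine (run_loop_induction (fun j A' => (∀ b, b ≠ a → A' b = A b) ∧
    ∀ i < j, A' a i = u.eval N A (i :: ρ)) ⟨fun _ _ => rfl, by simp⟩ ?_).2 i hi
  rintro j A' - ⟨h1, h2⟩
  refine ⟨fun b hb => ?_, fun i hi => ?_⟩
  · rw [run, Function.update_of_ne hb, h1 b hb]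
  · rw [run, Function.update_self]
    by_cases h : i = j
    · subst h
      simp only [Tm.eval, List.getD_cons_zero, Function.update_self]
      exact Tm.eval_congr _ fun b hb => h1 b (ne_of_mem_of_not_mem hb hu)
    · simp only [Tm.eval, List.getD_cons_zero]
      rw [Function.update_of_ne h]
      exact h2 i (by omega)

end St

/-! ## Decoding the input -/

theorem bits_nil : bits [] = [] := rfl

theorem bits_cons (v : ℕ) (l : List ℕ) :
    bits (v :: l) = List.replicate v true ++ false :: bits l := by
  simp [bits]

theorem bits_append (l l' : List ℕ) : bits (l ++ l') = bits l ++ bits l' := by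
  simp [bits]

theorem length_bits (l : List ℕ) : (bits l).length = (l.map (· + 1)).sum := by
  simp [bits, List.length_flatMap]

theorem length_le_length_bits (l : List ℕ) : l.length ≤ (bits l).length := by
  rw [length_bits]
  induction l with
  | nil => simp
  | cons v l ih => simp; omega

/-- One step of decoding: a table of numbers and the number of finished entries. -/
def decodeStep (p : (ℕ → ℕ) × ℕ) (x : Bool) : (ℕ → ℕ) × ℕ :=
  if x then (Function.update p.1 p.2 (p.1 p.2 + 1), p.2) else (p.1, p.2 + 1)

theorem foldl_decodeStep_replicate (v : ℕ) (f : ℕ → ℕ) (c : ℕ) :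
    (List.replicate v true).foldl decodeStep (f, c) = (Function.update f c (f c + v), c) := by
  induction v generalizing f with
  | zero => simp
  | succ v ih =>
    rw [List.replicate_succ, List.foldl_cons, decodeStep, if_pos rfl, ih]
    simp [add_assoc, add_comm 1 v]

/-- Generalized over the numbers `l'` already decoded. The entry at `l'.length` is still `0`, so
counting ones there produces the next number. -/
theorem foldl_decodeStep_bits (l l' : List ℕ) :
    (bits l).foldl decodeStep ((fun k => l'.getD k 0), l'.length) =
      ((fun k => (l' ++ l).getD k 0), (l' ++ l).length) := by
  induction l generalizing l' with
  | nil => simp [bits_nil]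
  | cons v l ih =>
    have h : (Function.update (fun k => l'.getD k 0) l'.length (l'.getD l'.length 0 + v)) =
        fun k => (l' ++ [v]).getD k 0 := by
      funext k
      by_cases hk : k = l'.length
      · subst hk
        simp
      · rw [Function.update_of_ne hk]
        by_cases hk' : k < l'.length
        · simp [List.getD_eq_getElem?_getD, List.getElem?_append_left hk']
        · rw [List.getD_eq_default _ _ (by omega), List.getD_eq_default _ _ (by simp; omega)]
    have h' : l'.length + 1 = (l' ++ [v]).length := by simp
    rw [bits_cons, List.foldl_append, foldl_decodeStep_replicate, List.foldl_cons, decodeStep,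
      if_neg (by simp), h, h', ih]
    simp

/-- The numbers of the input are put into array `2`, and how many there are into array `3`. -/
def decodeSt : St :=
  .loop (.seq (.ite (.read 0 (.var 0)) (.write 2 (.read 3 (.const 0))
      (.add (.read 2 (.read 3 (.const 0))) (.const 1))))
    (.ite (.not (.read 0 (.var 0))) (.write 3 (.const 0) (.add (.read 3 (.const 0)) (.const 1)))))

/-- Each round performs one `decodeStep`. Array `0` is never written, so the second test in the body
reads the same bit as the first. -/
theorem run_decodeSt (l : List ℕ) :
    let A := decodeSt.run (bits l).length [] (Store.ofInput (bits l)).arr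
    A 2 = (fun k => l.getD k 0) ∧ A 3 0 = l.length := by
  set w := bits l with hw
  have key := St.run_loop_induction (N := w.length) (ρ := []) (A := (Store.ofInput w).arr)
    (c := .seq (.ite (.read 0 (.var 0)) (.write 2 (.read 3 (.const 0))
      (.add (.read 2 (.read 3 (.const 0))) (.const 1))))
    (.ite (.not (.read 0 (.var 0))) (.write 3 (.const 0) (.add (.read 3 (.const 0)) (.const 1)))))
    (fun i A => A 0 = (Store.ofInput w).arr 0 ∧
      (A 2, A 3 0) = (w.take i).foldl decodeStep (fun _ => 0, 0)) ⟨rfl, rfl⟩ ?_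
  · have h := key.2
    rw [List.take_length, hw] at h
    have h2 := foldl_decodeStep_bits l []
    simp only [List.getD_nil, List.length_nil, List.nil_append] at h2
    rw [h2] at h
    exact ⟨congrArg Prod.fst h, congrArg Prod.snd h⟩
  · rintro i A hi ⟨h1, h2⟩
    refine ⟨(St.run_of_notMem_targets (by simp [St.targets]) _ _).trans h1, ?_⟩
    rw [List.take_add_one, List.foldl_append, ← h2, List.getElem?_eq_getElem hi]
    have h0 : A 0 i = w[i].toNat := by
      rw [h1]
      simp [Store.ofInput, List.getElem?_eq_getElem hi]
    cases hwi : w[i] with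
    | true => simp [St.run, Tm.eval, Tm.not, h0, hwi, decodeStep]
    | false => simp [St.run, Tm.eval, Tm.not, h0, hwi, decodeStep]

/-! ## Reading an instance -/

theorem getD_append_left (l l' : List ℕ) {k : ℕ} (h : k < l.length) :
    (l ++ l').getD k 0 = l.getD k 0 := by
  simp [List.getD_eq_getElem?_getD, List.getElem?_append_left h]

theorem getD_append_add (l l' : List ℕ) (k : ℕ) :
    (l ++ l').getD (l.length + k) 0 = l'.getD k 0 := by
  simp [List.getD_eq_getElem?_getD, List.getElem?_append_right]

theorem length_flatMap_finRange {n m : ℕ} (f : Fin n → Fin m → ℕ) :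
    ((List.finRange n).flatMap fun s => (List.finRange m).map fun t => f s t).length = n * m := by
  simp [List.length_flatMap]

theorem getD_flatMap_map {α : Type*} {m : ℕ} (l : List α) (f : α → Fin m → ℕ) (i : ℕ)
    (hi : i < l.length) (t : Fin m) :
    (l.flatMap fun s => (List.finRange m).map fun t => f s t).getD (i * m + t) 0 = f l[i] t := by
  induction l generalizing i with
  | nil => simp at hi
  | cons s l ih =>
    rw [List.flatMap_cons]
    cases i with
    | zero =>
      rw [getD_append_left _ _ (by simp)]
      simp [List.getD_eq_getElem?_getD]
    | succ i =>
      have h : (i + 1) * m + t = ((List.finRange m).map fun t => f s t).length + (i * m + t) := by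
        simp; ring
      rw [h, getD_append_add, ih i (by simpa using hi)]
      simp

theorem getD_flatMap_finRange {n m : ℕ} (f : Fin n → Fin m → ℕ) (s : Fin n) (t : Fin m) :
    ((List.finRange n).flatMap fun s => (List.finRange m).map fun t => f s t).getD (s * m + t) 0 =
      f s t := by
  rw [getD_flatMap_map _ _ s (by simp)]
  simp

theorem mul_add_lt_mul {n m : ℕ} (s : Fin n) (t : Fin m) : (s : ℕ) * m + t < n * m := by
  have h1 : ((s : ℕ) + 1) * m ≤ n * m := Nat.mul_le_mul_right m s.2
  rw [add_mul] at h1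
  have h2 := t.2
  omega

theorem mul_add_div_fin {m : ℕ} (s : ℕ) (t : Fin m) : (s * m + t) / m = s := by
  have := t.2
  rw [mul_comm, Nat.mul_add_div (by omega), Nat.div_eq_of_lt t.2, add_zero]

theorem mul_add_mod_fin {m : ℕ} (s : ℕ) (t : Fin m) : (s * m + t) % m = t := by
  rw [Nat.mul_add_mod_self_right, Nat.mod_eq_of_lt t.2]

namespace Domain

variable {n a : ℕ} (D : Domain (Fin n) (Fin a))

theorem length_code : D.code.length = 3 + n * n + n * a := by
  simp only [code, List.length_append, length_flatMap_finRange]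
  simp

theorem getD_code_zero : D.code.getD 0 0 = n := by simp [code]

theorem getD_code_one : D.code.getD 1 0 = a := by simp [code]

theorem getD_code_two : D.code.getD 2 0 = D.init := by simp [code]

theorem getD_code_trans (s s' : Fin n) :
    D.code.getD (3 + (s * n + s')) 0 = if (s, s') ∈ D.trans then 1 else 0 := by
  have h := mul_add_lt_mul s s'
  rw [code, getD_append_left _ _ (by
    simp only [List.length_append, length_flatMap_finRange]; simp; omega)]
  rw [show 3 = [n, a, D.init.val].length from rfl, getD_append_add, getD_flatMap_finRange]

theorem getD_code_label (s : Fin n) (p : Fin a) :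
    D.code.getD (3 + n * n + (s * a + p)) 0 = if p ∈ D.label s then 1 else 0 := by
  have h : 3 + n * n = ([n, a, D.init.val] ++
    ((List.finRange n).flatMap fun s => (List.finRange n).map fun s' =>
      if (s, s') ∈ D.trans then 1 else 0)).length := by
    simp only [List.length_append, length_flatMap_finRange]
    simp
  rw [code, h, getD_append_add, getD_flatMap_finRange]

end Domain

namespace Pointwise

/-- The tokens of the formulas of the specification. -/
def tokens {n m a b : ℕ} (I : Pointwise (Fin n) (Fin m) (Fin a) (Fin b)) : List ℕ :=
  I.maps.flatMap fun c => c.1.code ++ c.2.code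

/-- The numbers that describe an instance. -/
def code {n m a b : ℕ} (I : Pointwise (Fin n) (Fin m) (Fin a) (Fin b)) : List ℕ :=
  I.domA.code ++ I.domB.code ++ (I.maps.length :: I.tokens)

/-- The arrays contain the description of the instance. -/
structure Describes {n m a b : ℕ} (I : Pointwise (Fin n) (Fin m) (Fin a) (Fin b)) (A : Arrays) :
    Prop where
  code_eq : A 2 = fun k => I.code.getD k 0
  length_eq : A 3 0 = I.code.length

end Pointwise

namespace Tm

/-- The number of states of the first domain. -/
def numA : Tm := read 2 (const 0)

/-- The number of propositions of the first domain. -/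
def propA : Tm := read 2 (const 1)

/-- The initial state of the first domain. -/
def initA : Tm := read 2 (const 2)

/-- The offset of the labels of the first domain. -/
def labelOffsetA : Tm := add (const 3) (mul numA numA)

/-- The offset of the second domain. -/
def offsetB : Tm := add labelOffsetA (mul numA propA)

/-- The number of states of the second domain. -/
def numB : Tm := read 2 offsetB

/-- The number of propositions of the second domain. -/
def propB : Tm := read 2 (add offsetB (const 1))

/-- The initial state of the second domain. -/
def initB : Tm := read 2 (add offsetB (const 2))

/-- The offset of the labels of the second domain. -/
def labelOffsetB : Tm := add offsetB (add (const 3) (mul numB numB))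

/-- The offset of the specification. -/
def offsetMaps : Tm := add labelOffsetB (mul numB propB)

/-- Adjacency in the first domain. -/
def adjA (u v : Tm) : Tm := read 2 (add (const 3) (add (mul u numA) v))

/-- Adjacency in the second domain. -/
def adjB (u v : Tm) : Tm := read 2 (add offsetB (add (const 3) (add (mul u numB) v)))

/-- Labels of the first domain. -/
def labelA (u v : Tm) : Tm := read 2 (add labelOffsetA (add (mul u propA) v))

/-- Labels of the second domain. -/
def labelB (u v : Tm) : Tm := read 2 (add labelOffsetB (add (mul u propB) v))

/-- The code of a joint state. -/
def pair (u v : Tm) : Tm := add (mul u numB) v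

end Tm

namespace Pointwise

variable {n m a b : ℕ} (I : Pointwise (Fin n) (Fin m) (Fin a) (Fin b))

theorem input_eq : I.input = bits I.code := rfl

theorem getD_code_left (k : ℕ) (h : k < 3 + n * n + n * a) :
    I.code.getD k 0 = I.domA.code.getD k 0 := by
  rw [code, List.append_assoc, getD_append_left _ _ (by rwa [Domain.length_code])]

theorem getD_code_right (k : ℕ) (h : k < 3 + m * m + m * b) :
    I.code.getD (3 + n * n + n * a + k) 0 = I.domB.code.getD k 0 := by
  rw [code, List.append_assoc, ← I.domA.length_code, getD_append_add,
    getD_append_left _ _ (by rwa [Domain.length_code])]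

theorem length_code :
    I.code.length = 3 + n * n + n * a + (3 + m * m + m * b) + 1 + I.tokens.length := by
  rw [code, List.length_append, List.length_append, Domain.length_code, Domain.length_code,
    List.length_cons]
  omega

/-- The last `1` skips the number of clauses, which stands between the domains and the tokens. -/
theorem drop_code :
    I.code.drop (3 + n * n + n * a + (3 + m * m + m * b) + 1) = I.tokens := by
  have h : 3 + n * n + n * a + (3 + m * m + m * b) = (I.domA.code ++ I.domB.code).length := by
    rw [List.length_append, Domain.length_code, Domain.length_code]
  rw [code, h, List.drop_append]
  simp

theorem pos_right {n m a b : ℕ} (I : Pointwise (Fin n) (Fin m) (Fin a) (Fin b)) : 0 < m :=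
  Fin.pos I.domB.init

theorem length_code_lt : I.code.length ≤ I.input.length := length_le_length_bits _

/-- The two adjacency matrices contribute `n * n + m * m` entries, and `2 * n * m` is at most that.
-/
theorem mul_lt_length : n * m < I.input.length := by
  have h1 := I.length_code
  have h2 := I.length_code_lt
  nlinarith [sq_nonneg ((n : ℤ) - m), Nat.zero_le (n * a), Nat.zero_le (m * b),
    two_mul_le_add_sq (n : ℕ) m]

theorem left_lt_length : n < I.input.length := by
  have h1 := I.length_code
  have h2 := I.length_code_lt
  nlinarith [Nat.zero_le (n * a), Nat.zero_le (m * b), Nat.zero_le (m * m), Nat.le_mul_self n]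

theorem right_lt_length : m < I.input.length := by
  have h1 := I.length_code
  have h2 := I.length_code_lt
  nlinarith [Nat.zero_le (n * a), Nat.zero_le (m * b), Nat.zero_le (n * n), Nat.le_mul_self m]

namespace Describes

open Tm

variable {I} {A : Arrays} {ρ : List ℕ} {u v : Tm}

local notation "M" => List.length (Pointwise.input I)

theorem code_apply (h : I.Describes A) (k : ℕ) : A 2 k = I.code.getD k 0 := congrFun h.code_eq k

theorem eval_numA (h : I.Describes A) : numA.eval M A ρ = n := by
  rw [numA, eval, eval, h.code_apply]
  exact (I.getD_code_left 0 (by omega)).trans I.domA.getD_code_zero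

theorem eval_propA (h : I.Describes A) : propA.eval M A ρ = a := by
  rw [propA, eval, eval, h.code_apply]
  exact (I.getD_code_left 1 (by omega)).trans I.domA.getD_code_one

theorem eval_initA (h : I.Describes A) : initA.eval M A ρ = I.domA.init := by
  rw [initA, eval, eval, h.code_apply]
  exact (I.getD_code_left 2 (by omega)).trans I.domA.getD_code_two

theorem eval_labelOffsetA (h : I.Describes A) :
    labelOffsetA.eval M A ρ = 3 + n * n := by
  have := I.left_lt_length
  rw [labelOffsetA, eval, eval_mul (by rw [h.eval_numA]; omega), h.eval_numA, eval]

theorem eval_offsetB (h : I.Describes A) : offsetB.eval M A ρ = 3 + n * n + n * a := by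
  have := I.left_lt_length
  rw [offsetB, eval, eval_mul (by rw [h.eval_numA]; omega), h.eval_labelOffsetA, h.eval_numA,
    h.eval_propA]

theorem eval_numB (h : I.Describes A) : numB.eval M A ρ = m := by
  rw [numB, eval, h.eval_offsetB, h.code_apply]
  exact (I.getD_code_right 0 (by omega)).trans I.domB.getD_code_zero

theorem eval_propB (h : I.Describes A) : propB.eval M A ρ = b := by
  rw [propB, eval, eval, eval, h.eval_offsetB, h.code_apply]
  exact (I.getD_code_right 1 (by omega)).trans I.domB.getD_code_one

theorem eval_initB (h : I.Describes A) : initB.eval M A ρ = I.domB.init := by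
  rw [initB, eval, eval, eval, h.eval_offsetB, h.code_apply]
  exact (I.getD_code_right 2 (by omega)).trans I.domB.getD_code_two

theorem eval_labelOffsetB (h : I.Describes A) :
    labelOffsetB.eval M A ρ = 3 + n * n + n * a + (3 + m * m) := by
  have := I.right_lt_length
  rw [labelOffsetB, eval, eval, eval_mul (by rw [h.eval_numB]; omega), h.eval_numB,
    h.eval_offsetB, eval]

theorem eval_offsetMaps (h : I.Describes A) :
    offsetMaps.eval M A ρ = 3 + n * n + n * a + (3 + m * m + m * b) := by
  have := I.right_lt_length
  rw [offsetMaps, eval, eval_mul (by rw [h.eval_numB]; omega), h.eval_labelOffsetB, h.eval_numB,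
    h.eval_propB]
  omega

theorem eval_adjA (h : I.Describes A) {s s' : Fin n} (hu : u.eval M A ρ = s)
    (hv : v.eval M A ρ = s') : (adjA u v).eval M A ρ ≠ 0 ↔ (s, s') ∈ I.domA.trans := by
  have := I.left_lt_length
  have hs := mul_add_lt_mul s s'
  rw [adjA, eval, eval, eval, eval, eval_mul (by rw [hu]; omega), hu, hv, h.eval_numA, h.code_apply,
    I.getD_code_left _ (by omega), Domain.getD_code_trans]
  simp

theorem eval_adjB (h : I.Describes A) {t t' : Fin m} (hu : u.eval M A ρ = t)
    (hv : v.eval M A ρ = t') : (adjB u v).eval M A ρ ≠ 0 ↔ (t, t') ∈ I.domB.trans := by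
  have := I.right_lt_length
  have hs := mul_add_lt_mul t t'
  rw [adjB, eval, eval, eval, eval, eval, eval_mul (by rw [hu]; omega), hu, hv, h.eval_numB,
    h.eval_offsetB, h.code_apply, I.getD_code_right _ (by omega), Domain.getD_code_trans]
  simp

theorem eval_labelA (h : I.Describes A) {s : Fin n} (hu : u.eval M A ρ = s) :
    (labelA u v).eval M A ρ = I.code.getD (3 + n * n + (s * a + v.eval M A ρ)) 0 := by
  have := I.left_lt_length
  rw [labelA, eval, eval, eval, eval_mul (by rw [hu]; omega), hu, h.eval_propA,
    h.eval_labelOffsetA, h.code_apply]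

theorem eval_labelB (h : I.Describes A) {t : Fin m} (hu : u.eval M A ρ = t) :
    (labelB u v).eval M A ρ =
      I.code.getD (3 + n * n + n * a + (3 + m * m + (t * b + v.eval M A ρ))) 0 := by
  have := I.right_lt_length
  rw [labelB, eval, eval, eval, eval_mul (by rw [hu]; omega), hu, h.eval_propB,
    h.eval_labelOffsetB, h.code_apply, add_assoc (3 + n * n + n * a)]

theorem eval_pair (h : I.Describes A) {s : Fin n} (hu : u.eval M A ρ = s) :
    (pair u v).eval M A ρ = s * m + v.eval M A ρ := by
  have := I.left_lt_length
  rw [pair, eval, eval_mul (by rw [hu]; omega), hu, h.eval_numB]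

theorem eval_div_pair (h : I.Describes A) (s : Fin n) (t : Fin m)
    (hu : u.eval M A ρ = s * m + t) : (div u numB).eval M A ρ = s := by
  have h1 := I.mul_lt_length
  have h2 := mul_add_lt_mul s t
  rw [eval_div (by omega) (by rw [h.eval_numB]; exact I.pos_right), h.eval_numB, hu,
    mul_add_div_fin]

theorem eval_mod_pair (h : I.Describes A) (s : Fin n) (t : Fin m)
    (hu : u.eval M A ρ = s * m + t) : (mod u numB).eval M A ρ = t := by
  have h1 := I.mul_lt_length
  have h2 := mul_add_lt_mul s t
  rw [eval_mod (by omega) (by rw [h.eval_numB]; exact I.pos_right), h.eval_numB, hu,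
    mul_add_mod_fin]

/-- The description occupies arrays `2` and `3` only, so it survives every statement that does not
write to them. -/
theorem of_eq {A' : Arrays} (h : I.Describes A) (h2 : A' 2 = A 2) (h3 : A' 3 = A 3) :
    I.Describes A' := ⟨h2.trans h.code_eq, (congrFun h3 0).trans h.length_eq⟩

end Describes

end Pointwise

theorem describes_run_decodeSt {n m a b : ℕ} (I : Pointwise (Fin n) (Fin m) (Fin a) (Fin b)) :
    I.Describes (decodeSt.run I.input.length [] (Store.ofInput I.input).arr) :=
  ⟨(run_decodeSt I.code).1, (run_decodeSt I.code).2⟩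

/-! ## Evaluation of the specification by a stack machine -/

/-- A stack machine that checks implications between formulas in postfix notation: `flag` says
whether the conclusion of an implication is being read, `ok` whether all implications were true. -/
structure Mach where
  stk : ℕ → ℕ
  sp : ℕ
  flag : ℕ
  ok : ℕ

namespace Mach

/-- The effect of a token; `lab` gives the truth values of the propositions. -/
def step (lab : ℕ → ℕ → ℕ) (K : Mach) : ℕ → Mach
  | 0 => { K with
      sp := if K.flag ≠ 0 then 0 else K.sp
      flag := if K.flag ≠ 0 then 0 else 1
      ok := if K.flag ≠ 0 then
          if K.stk (K.sp - 2) ≠ 0 then if K.stk (K.sp - 1) ≠ 0 then K.ok else 0 else K.ok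
        else K.ok }
  | 1 => { K with
      stk := Function.update K.stk (K.sp - 1) (if K.stk (K.sp - 1) ≠ 0 then 0 else 1) }
  | 2 => { K with
      stk := Function.update K.stk (K.sp - 2)
        (if K.stk (K.sp - 2) ≠ 0 then K.stk (K.sp - 1) else 0)
      sp := K.sp - 1 }
  | 3 => { K with
      stk := Function.update K.stk (K.sp - 2)
        (if K.stk (K.sp - 2) ≠ 0 then 1 else K.stk (K.sp - 1))
      sp := K.sp - 1 }
  | p + 4 => { K with
      stk := Function.update K.stk K.sp (lab K.flag p)
      sp := K.sp + 1 }

variable {lab : ℕ → ℕ → ℕ}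

/-- `K'` arises from `K` by pushing a truth value for `q`. -/
structure Pushed (K K' : Mach) (q : Prop) : Prop where
  sp_eq : K'.sp = K.sp + 1
  flag_eq : K'.flag = K.flag
  ok_eq : K'.ok = K.ok
  stk_eq : ∀ i < K.sp, K'.stk i = K.stk i
  top_iff : K'.stk K.sp ≠ 0 ↔ q

/-- Usual correctness of postfix evaluation. It has to include that the stack below `K.sp` is
untouched and that `flag` is preserved, so that the operands of a binary connective do not disturb
each other. -/
theorem pushed_foldl_go {c : ℕ} (X : Finset (Fin c)) (φ : BoolFormula (Fin c)) (K : Mach)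
    (hlab : ∀ p : Fin c, lab K.flag p = if p ∈ X then 1 else 0) :
    Pushed K ((BoolFormula.code.go φ).foldl (step lab) K) (φ.Holds X) := by
  induction φ generalizing K with
  | atom p =>
    refine ⟨rfl, rfl, rfl, fun i hi => Function.update_of_ne (by omega) _ _, ?_⟩
    simp [BoolFormula.code.go, step, hlab, BoolFormula.Holds]
  | neg φ ih =>
    have h := ih K hlab
    rw [BoolFormula.code.go, List.foldl_append]
    generalize (BoolFormula.code.go φ).foldl (step lab) K = K₁ at h
    obtain ⟨h1, h2, h3, h4, h5⟩ := h
    refine ⟨h1, h2, h3, fun i hi => ?_, ?_⟩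
    · simp only [List.foldl_cons, List.foldl_nil, step]
      rw [Function.update_of_ne (by omega), h4 i hi]
    · simp [step, h1, BoolFormula.Holds, ← h5]
  | and φ ψ ih ih' =>
    have h := ih K hlab
    rw [BoolFormula.code.go, List.foldl_append, List.foldl_append]
    generalize (BoolFormula.code.go φ).foldl (step lab) K = K₁ at h
    have h' := ih' K₁ (by rw [h.flag_eq]; exact hlab)
    generalize (BoolFormula.code.go ψ).foldl (step lab) K₁ = K₂ at h'
    obtain ⟨h1, h2, h3, h4, h5⟩ := h
    obtain ⟨h1', h2', h3', h4', h5'⟩ := h'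
    -- The value of the first operand survives the evaluation of the second.
    have e := h4' K.sp (by omega)
    rw [h1] at h5'
    refine ⟨by simp [step, h1', h1], h2'.trans h2, h3'.trans h3, fun i hi => ?_, ?_⟩
    · simp only [List.foldl_cons, List.foldl_nil, step]
      rw [Function.update_of_ne (by omega), h4' i (by omega), h4 i hi]
    · simp [step, h1', h1, BoolFormula.Holds, ← h5, ← h5', e]
  | or φ ψ ih ih' =>
    have h := ih K hlab
    rw [BoolFormula.code.go, List.foldl_append, List.foldl_append]
    generalize (BoolFormula.code.go φ).foldl (step lab) K = K₁ at h
    have h' := ih' K₁ (by rw [h.flag_eq]; exact hlab)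
    generalize (BoolFormula.code.go ψ).foldl (step lab) K₁ = K₂ at h'
    obtain ⟨h1, h2, h3, h4, h5⟩ := h
    obtain ⟨h1', h2', h3', h4', h5'⟩ := h'
    have e := h4' K.sp (by omega)
    rw [h1] at h5'
    refine ⟨by simp [step, h1', h1], h2'.trans h2, h3'.trans h3, fun i hi => ?_, ?_⟩
    · simp only [List.foldl_cons, List.foldl_nil, step]
      rw [Function.update_of_ne (by omega), h4' i (by omega), h4 i hi]
    · simp [step, h1', h1, BoolFormula.Holds, ← h5, ← h5', e]
      by_cases h0 : K₁.stk K.sp = 0 <;> simp [h0]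

/-- The first closing `0` only raises the flag, so the premise stays at stack position 0 and the
conclusion is read with the labels of the other domain into position 1. The second `0` combines the
two into `ok` and resets pointer and flag for the next clause. -/
theorem foldl_clause {c d : ℕ} (X : Finset (Fin c)) (Y : Finset (Fin d))
    (hX : ∀ p : Fin c, lab 0 p = if p ∈ X then 1 else 0)
    (hY : ∀ p : Fin d, lab 1 p = if p ∈ Y then 1 else 0)
    (φ : BoolFormula (Fin c)) (ψ : BoolFormula (Fin d)) (K : Mach) (hsp : K.sp = 0)
    (hflag : K.flag = 0) :
    let K' := (φ.code ++ ψ.code).foldl (step lab) K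
    K'.sp = 0 ∧ K'.flag = 0 ∧ (K'.ok ≠ 0 ↔ K.ok ≠ 0 ∧ (φ.Holds X → ψ.Holds Y)) := by
  have h := pushed_foldl_go (lab := lab) X φ K (by rw [hflag]; exact hX)
  rw [BoolFormula.code, BoolFormula.code, List.foldl_append, List.foldl_append, List.foldl_append]
  generalize (BoolFormula.code.go φ).foldl (step lab) K = K₁ at h
  obtain ⟨h1, h2, h3, h4, h5⟩ := h
  have h' := pushed_foldl_go (lab := lab) Y ψ (step lab K₁ 0) (by
    rw [show (step lab K₁ 0).flag = 1 by simp [step, h2, hflag]]; exact hY)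
  have e : [0].foldl (step lab) K₁ = step lab K₁ 0 := rfl
  rw [e]
  generalize (BoolFormula.code.go ψ).foldl (step lab) (step lab K₁ 0) = K₂ at h'
  obtain ⟨h1', h2', h3', h4', h5'⟩ := h'
  have hs : (step lab K₁ 0).sp = 1 := by simp [step, h2, hflag, h1, hsp]
  have hf : K₂.flag = 1 := by rw [h2']; simp [step, h2, hflag]
  have ho : K₂.ok = K.ok := by rw [h3']; simp [step, h2, hflag, h3]
  have h0 : K₂.stk 0 = K₁.stk 0 := h4' 0 (by omega)
  rw [hs] at h1' h5'
  rw [hsp] at h5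
  refine ⟨by simp [step, hf], by simp [step, hf], ?_⟩
  simp only [List.foldl_cons, List.foldl_nil, step, hf, h1', ho]
  rw [← h5, ← h5', ← h0]
  by_cases hA : K₂.stk 0 = 0 <;> by_cases hB : K₂.stk 1 = 0 <;> simp [hA, hB]

theorem foldl_clauses {c d : ℕ} (X : Finset (Fin c)) (Y : Finset (Fin d))
    (hX : ∀ p : Fin c, lab 0 p = if p ∈ X then 1 else 0)
    (hY : ∀ p : Fin d, lab 1 p = if p ∈ Y then 1 else 0)
    (l : List (BoolFormula (Fin c) × BoolFormula (Fin d))) (K : Mach) (hsp : K.sp = 0)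
    (hflag : K.flag = 0) :
    ((l.flatMap fun e => e.1.code ++ e.2.code).foldl (step lab) K).ok ≠ 0 ↔
      K.ok ≠ 0 ∧ ∀ e ∈ l, e.1.Holds X → e.2.Holds Y := by
  induction l generalizing K with
  | nil => simp
  | cons e l ih =>
    obtain ⟨h1, h2, h3⟩ := foldl_clause X Y hX hY e.1 e.2 K hsp hflag
    rw [List.flatMap_cons, List.foldl_append, ih _ h1 h2, h3]
    simp [and_assoc]

/-- The machine represented in arrays `5` and `6`. -/
def ofArrays (A : Arrays) : Mach where
  stk := A 5
  sp := A 6 0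
  flag := A 6 1
  ok := A 6 2

end Mach

namespace Tm

/-- The current token. -/
def token : Tm := read 2 (var 0)

/-- The stack pointer. -/
def sp : Tm := read 6 (const 0)

/-- The flag of the stack machine. -/
def flag : Tm := read 6 (const 1)

/-- The result of the stack machine. -/
def ok : Tm := read 6 (const 2)

/-- The value on top of the stack. -/
def top : Tm := read 5 (sub sp (const 1))

/-- The second value on the stack. -/
def second : Tm := read 5 (sub sp (const 2))

/-- The truth value of the proposition named by the current token. -/
def tokenLabel : Tm :=
  ite flag (labelB (mod (var 1) numB) (sub token (const 4)))
    (labelA (div (var 1) numB) (sub token (const 4)))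

end Tm

/-- One step of the stack machine. -/
def tokenSt : St :=
  .seq (.ite (.not .token) (.seq (.write 6 (.const 2)
      (.ite .flag (.ite .second (.ite .top .ok (.const 0)) .ok) .ok))
      (.seq (.write 6 (.const 0) (.ite .flag (.const 0) .sp))
        (.write 6 (.const 1) (.not .flag)))))
  (.seq (.ite (.eq .token (.const 1)) (.write 5 (.sub .sp (.const 1)) (.not .top)))
  (.seq (.ite (.eq .token (.const 2)) (.seq (.write 5 (.sub .sp (.const 2))
      (.ite .second .top (.const 0))) (.write 6 (.const 0) (.sub .sp (.const 1)))))
  (.seq (.ite (.eq .token (.const 3)) (.seq (.write 5 (.sub .sp (.const 2))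
      (.ite .second (.const 1) .top)) (.write 6 (.const 0) (.sub .sp (.const 1)))))
  (.ite (.lt (.const 3) .token) (.seq (.write 5 .sp .tokenLabel)
      (.write 6 (.const 0) (.add .sp (.const 1))))))))

/-- The stack machine is run on all tokens. -/
def tokensSt : St :=
  .loop (.ite (.and (.lt .offsetMaps (.var 0)) (.lt (.var 0) (.read 3 (.const 0)))) tokenSt)

/-- The truth values of the specification in the joint states are put into array `4`. -/
def goalSt : St :=
  .loop (.seq (.write 6 (.const 0) (.const 0)) (.seq (.write 6 (.const 1) (.const 0))
    (.seq (.write 6 (.const 2) (.const 1)) (.seq tokensSt (.write 4 (.var 0) .ok)))))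

namespace Pointwise

variable {n m a b : ℕ} (I : Pointwise (Fin n) (Fin m) (Fin a) (Fin b))

/-- The entries of the tables of labels. -/
def labelValue (s : Fin n) (t : Fin m) (f p : ℕ) : ℕ :=
  if f ≠ 0 then I.code.getD (3 + n * n + n * a + (3 + m * m + (t * b + p))) 0
  else I.code.getD (3 + n * n + (s * a + p)) 0

theorem labelValue_zero (s : Fin n) (t : Fin m) (p : Fin a) :
    I.labelValue s t 0 p = if p ∈ I.domA.label s then 1 else 0 := by
  have := mul_add_lt_mul s p
  rw [labelValue, if_neg (by simp), I.getD_code_left _ (by omega), Domain.getD_code_label]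

theorem labelValue_one (s : Fin n) (t : Fin m) (p : Fin b) :
    I.labelValue s t 1 p = if p ∈ I.domB.label t then 1 else 0 := by
  have := mul_add_lt_mul t p
  rw [labelValue, if_pos (by simp), I.getD_code_right _ (by omega), Domain.getD_code_label]

variable {I}

theorem Describes.eval_tokenLabel {A : Arrays} (h : I.Describes A) (s : Fin n) (t : Fin m)
    (j : ℕ) (ρ : List ℕ) :
    Tm.tokenLabel.eval I.input.length A (j :: (s * m + t) :: ρ) =
      I.labelValue s t (A 6 1) (A 2 j - 4) := by
  rw [Tm.tokenLabel, Tm.eval, h.eval_labelA (h.eval_div_pair s t rfl),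
    h.eval_labelB (h.eval_mod_pair s t rfl)]
  rfl

/-- The five tests exclude each other and look only at array `2`, which is not written. Within a
branch, values are overwritten only after their last use: `ok` before the pointer, the pointer
before the flag. -/
theorem Describes.run_tokenSt {A : Arrays} (h : I.Describes A) (s : Fin n) (t : Fin m)
    (j : ℕ) (ρ : List ℕ) :
    Mach.ofArrays (tokenSt.run I.input.length (j :: (s * m + t) :: ρ) A) =
      (Mach.ofArrays A).step (I.labelValue s t) (A 2 j) := by
  have hl := h.eval_tokenLabel s t j ρ
  rcases hv : A 2 j with _ | _ | _ | _ | p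
  all_goals
    rw [hv] at hl
    simp [tokenSt, St.run, Tm.eval, Tm.not, Tm.token, Tm.eq, Tm.lt, hv, Mach.step,
      Mach.ofArrays, Tm.flag, Tm.sp, Tm.ok, Tm.top, Tm.second, hl]
    try (split_ifs <;> simp_all <;> rfl)

/-- The loop passes over all indices; the guard admits those behind the number of clauses, at index
`o`, and before the end of the code. After `j` rounds the tokens with indices from `o + 1` up to but
excluding `j` have been processed. -/
theorem Describes.run_tokensSt {A : Arrays} (h : I.Describes A) (s : Fin n) (t : Fin m)
    (ρ : List ℕ) :
    Mach.ofArrays (tokensSt.run I.input.length ((s * m + t) :: ρ) A) =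
      I.tokens.foldl (Mach.step (I.labelValue s t)) (Mach.ofArrays A) := by
  set o := 3 + n * n + n * a + (3 + m * m + m * b) with ho
  have key := St.run_loop_induction (N := I.input.length) (ρ := (s * m + t) :: ρ) (A := A)
    (c := .ite (.and (.lt .offsetMaps (.var 0)) (.lt (.var 0) (.read 3 (.const 0)))) tokenSt)
    (fun j A' => I.Describes A' ∧ Mach.ofArrays A' =
      ((I.code.take j).drop (o + 1)).foldl (Mach.step (I.labelValue s t)) (Mach.ofArrays A))
    ⟨h, by simp⟩ ?_
  · rw [List.take_of_length_le I.length_code_lt, ho, I.drop_code] at key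
    exact key.2
  · rintro j A' hj ⟨h1, h2⟩
    refine ⟨h1.of_eq (St.run_of_notMem_targets (by simp [St.targets, tokenSt]) _ _)
      (St.run_of_notMem_targets (by simp [St.targets, tokenSt]) _ _), ?_⟩
    have hc : (Tm.and (.lt .offsetMaps (.var 0)) (.lt (.var 0) (.read 3 (.const 0)))).eval
        I.input.length A' (j :: (s * m + t) :: ρ) ≠ 0 ↔ o < j ∧ j < I.code.length := by
      rw [Tm.eval_and_ne_zero, Tm.eval_lt_ne_zero, Tm.eval_lt_ne_zero, h1.eval_offsetMaps]
      simp only [Tm.eval, h1.length_eq]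
      rfl
    rw [St.run]
    by_cases hj' : o < j ∧ j < I.code.length
    · rw [if_pos (hc.2 hj'), h1.run_tokenSt, h2, List.take_add_one, List.drop_append,
        List.foldl_append, List.getElem?_eq_getElem hj'.2, h1.code_apply,
        show o + 1 - (I.code.take j).length = 0 by simp; omega, List.getD_eq_getElem _ _ hj'.2]
      rfl
    · rw [if_neg (hc.not.2 hj'), h2]
      -- Outside the guard the processed segment does not grow: either the code is exhausted or the
      -- tokens have not begun.
      by_cases hjo : o < j
      · rw [List.take_of_length_le (by omega), List.take_of_length_le (by omega)]
      · rw [List.drop_eq_nil_of_le (by simp; omega), List.drop_eq_nil_of_le (by simp; omega)]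

/-- Round `x` settles the joint state with code `x` and leaves the other entries of array `4` alone.
Rounds with `x` not a code may write anything, since only entries at codes are claimed. -/
theorem Describes.run_goalSt {A : Arrays} (h : I.Describes A) (ρ : List ℕ) (s : Fin n)
    (t : Fin m) :
    goalSt.run I.input.length ρ A 4 (s * m + t) ≠ 0 ↔ (s, t) ∈ I.goal := by
  refine (St.run_loop_induction (fun x A' => I.Describes A' ∧ ∀ (s : Fin n) (t : Fin m),
    s * m + t < x → (A' 4 (s * m + t) ≠ 0 ↔ (s, t) ∈ I.goal)) ⟨h, fun s t hx => by omega⟩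
    ?_).2 s t ((mul_add_lt_mul s t).trans I.mul_lt_length)
  rintro x A' hx ⟨h1, h2⟩
  refine ⟨h1.of_eq (St.run_of_notMem_targets (by simp [St.targets, tokensSt, tokenSt]) _ _)
    (St.run_of_notMem_targets (by simp [St.targets, tokensSt, tokenSt]) _ _), fun s t hst => ?_⟩
  set A₁ := St.run I.input.length (x :: ρ) (.write 6 (.const 2) (.const 1))
    (St.run I.input.length (x :: ρ) (.write 6 (.const 1) (.const 0))
      (St.run I.input.length (x :: ρ) (.write 6 (.const 0) (.const 0)) A')) with hA₁
  have hD : I.Describes A₁ := h1.of_eq (by simp [hA₁, St.run]) (by simp [hA₁, St.run])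
  have h4 : A₁ 4 = A' 4 := by simp [hA₁, St.run]
  have h4' : tokensSt.run I.input.length (x :: ρ) A₁ 4 = A' 4 :=
    (St.run_of_notMem_targets (by simp [St.targets, tokensSt, tokenSt]) _ _).trans h4
  change (St.write 4 (.var 0) .ok).run I.input.length (x :: ρ)
    (tokensSt.run I.input.length (x :: ρ) A₁) 4 (s * m + t) ≠ 0 ↔ _
  rw [St.run, Function.update_self]
  by_cases hx' : s * m + t = x
  · subst hx'
    simp only [Tm.eval, List.getD_cons_zero, Function.update_self, Tm.ok]
    have hK := congrArg Mach.ok (hD.run_tokensSt s t ρ)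
    rw [show (tokensSt.run I.input.length ((s * m + t) :: ρ) A₁) 6 2 = _ from hK,
      tokens, Mach.foldl_clauses _ _ (I.labelValue_zero s t) (I.labelValue_one s t) _ _
        (by simp [Mach.ofArrays, hA₁, St.run, Tm.eval])
        (by simp [Mach.ofArrays, hA₁, St.run, Tm.eval])]
    simp [Mach.ofArrays, hA₁, St.run, Tm.eval, goal]
  · simp only [Tm.eval, List.getD_cons_zero]
    rw [Function.update_of_ne hx', h4']
    exact h2 s t (by omega)

end Pointwise

/-! ## The largest winning set -/

/-- As long as the iteration has not become stationary, each round loses at least one element, which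
can happen at most `Nat.card α` times. -/
theorem iterate_fixed_of_card_lt {α : Type*} [Finite α] (f : Set α → Set α) (hf : ∀ W, f W ⊆ W)
    (W : Set α) {N : ℕ} (hN : Nat.card α < N) : f (f^[N] W) = f^[N] W := by
  have key : ∀ k, f (f^[k] W) = f^[k] W ∨ (f^[k] W).ncard + k ≤ Nat.card α := by
    intro k
    induction k with
    | zero => exact Or.inr (Set.ncard_le_card _)
    | succ k ih =>
      rw [Function.iterate_succ_apply']
      by_cases h : f (f^[k] W) = f^[k] W
      · left
        rw [h, h]
      · right
        have h1 := ih.resolve_left h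
        have h2 := Set.ncard_lt_ncard ((hf (f^[k] W)).ssubset_of_ne h) (Set.toFinite _)
        omega
  exact (key N).resolve_right (by omega)

namespace Pointwise

section Stay

variable {S T PA PB : Type*} (I : Pointwise S T PA PB)

/-- The joint states of `W` in which agent `B` can answer every move within `W`. -/
def stay (W : Set (S × T)) : Set (S × T) :=
  {u | u ∈ W ∧ ∀ s', (u.1, s') ∈ I.domA.trans → ∃ t', (u.2, t') ∈ I.domB.trans ∧ (s', t') ∈ W}

theorem stay_subset (W : Set (S × T)) : I.stay W ⊆ W := fun _ h => h.1

theorem iterate_stay_subset (W : Set (S × T)) (k : ℕ) : I.stay^[k] W ⊆ W := by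
  induction k with
  | zero => exact subset_rfl
  | succ k ih =>
    rw [Function.iterate_succ_apply']
    exact (I.stay_subset _).trans ih

/-- `stay` is monotone and a winning set satisfies `W ⊆ stay W`, so no iteration removes any of its
elements. -/
theorem IsWinSet.subset_iterate_stay {W : Set (S × T)} (hW : I.IsWinSet W) (k : ℕ) :
    W ⊆ I.stay^[k] I.goal := by
  induction k with
  | zero => exact hW.subset_goal
  | succ k ih =>
    rw [Function.iterate_succ_apply']
    rintro ⟨s, t⟩ hu
    refine ⟨ih hu, fun s' hs' => ?_⟩
    obtain ⟨t', ht', hu'⟩ := hW.exists_response s t hu s' hs'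
    exact ⟨t', ht', ih hu'⟩

/-- At a fixed point of `stay`, the defining condition of `stay` is the response condition. -/
theorem isWinSet_iterate_stay [Finite S] [Finite T] {N : ℕ} (hN : Nat.card (S × T) < N) :
    I.IsWinSet (I.stay^[N] I.goal) where
  subset_goal := I.iterate_stay_subset _ _
  exists_response s t h := by
    rw [← iterate_fixed_of_card_lt I.stay I.stay_subset I.goal hN] at h
    exact h.2

end Stay

/-- The nonzero entries of an array represent a set of joint states. -/
def Represents {n m : ℕ} (f : ℕ → ℕ) (W : Set (Fin n × Fin m)) : Prop :=
  ∀ (s : Fin n) (t : Fin m), f (s * m + t) ≠ 0 ↔ (s, t) ∈ W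

end Pointwise

namespace Tm

/-- The second agent may move from `v` to `w`, and `(u, w)` is in the set in array `4`. -/
def answer (u v w : Tm) : Tm := and (lt w numB) (and (adjB v w) (read 4 (pair u w)))

/-- Membership in the set of the joint states in which the second agent can stay in the set in
array `4`. -/
def stay : Tm :=
  call (and (read 4 (pair (var 0) (var 1))) (not (ex (and (and (lt (var 0) numA)
    (adjA (var 1) (var 0))) (not (ex (answer (var 1) (var 3) (var 0))))))))
    (div (var 0) numB) (mod (var 0) numB) (const 0)

/-- The first answer. -/
def table : Tm :=
  call (sum (ite (and (answer (var 1) (var 2) (var 0)) (not (ex (and (lt (var 0) (var 1))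
    (answer (var 2) (var 3) (var 0)))))) (var 0) (const 0)))
    (div (var 0) numB) (mod (var 0) numB) (const 0)

end Tm

/-- The set in array `4` is replaced by the joint states in which agent `B` can stay in it. -/
def staySt : St := .seq (St.fill 7 .stay) (St.fill 4 (.read 7 (.var 0)))

/-- At most one summand is nonzero, the one at the least index satisfying `P`; the sum is thus this
index, or `0` if there is none. This is bounded minimization by means of a sum. -/
theorem sum_first_eq (N : ℕ) (P : ℕ → Prop) [DecidablePred fun i => P i ∧ ¬ ∃ j < N, j < i ∧ P j] :
    (∀ i < N, ¬ P i) ∧ (∑ i ∈ Finset.range N, if P i ∧ ¬ ∃ j < N, j < i ∧ P j then i else 0) = 0 ∨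
      P (∑ i ∈ Finset.range N, if P i ∧ ¬ ∃ j < N, j < i ∧ P j then i else 0) := by
  classical
  by_cases h : ∃ i, i < N ∧ P i
  · right
    obtain ⟨h1, h2⟩ := Nat.find_spec h
    have h3 : ∀ j < Nat.find h, ¬ (j < N ∧ P j) := fun j hj => Nat.find_min h hj
    rw [Finset.sum_eq_single_of_mem (Nat.find h) (Finset.mem_range.2 h1)]
    · rw [if_pos ⟨h2, fun ⟨j, hj, hj', hp⟩ => h3 j hj' ⟨hj, hp⟩⟩]
      exact h2
    · intro i hi hne
      rw [Finset.mem_range] at hi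
      rw [if_neg]
      rintro ⟨hp, hn⟩
      rcases lt_or_gt_of_ne hne with hlt | hgt
      · exact h3 i hlt ⟨hi, hp⟩
      · exact hn ⟨_, h1, hgt, h2⟩
  · left
    push Not at h
    refine ⟨h, Finset.sum_eq_zero fun i hi => if_neg fun hp => h i (Finset.mem_range.1 hi) hp.1⟩

namespace Pointwise.Describes

variable {n m a b : ℕ} {I : Pointwise (Fin n) (Fin m) (Fin a) (Fin b)} {A : Arrays}
  {ρ : List ℕ} {u v w : Tm} {W : Set (Fin n × Fin m)}

local notation "M" => List.length (Pointwise.input I)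

/-- The candidate `w` ranges over all numbers below the loop length; the test against `numB` makes
it an actual state. -/
theorem eval_answer (h : I.Describes A) (hW : Represents (A 4) W) {s : Fin n} {t : Fin m}
    (hu : u.eval M A ρ = s) (hv : v.eval M A ρ = t) :
    (Tm.answer u v w).eval M A ρ ≠ 0 ↔
      ∃ t' : Fin m, (t' : ℕ) = w.eval M A ρ ∧ (t, t') ∈ I.domB.trans ∧ (s, t') ∈ W := by
  rw [Tm.answer, Tm.eval_and_ne_zero, Tm.eval_lt_ne_zero, Tm.eval_and_ne_zero, h.eval_numB]
  constructor
  · rintro ⟨h1, h2, h3⟩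
    refine ⟨⟨_, h1⟩, rfl, (h.eval_adjB hv rfl).1 h2, ?_⟩
    rw [Tm.eval, h.eval_pair hu] at h3
    exact (hW s ⟨_, h1⟩).1 h3
  · rintro ⟨t', ht', h1, h2⟩
    refine ⟨ht' ▸ t'.2, (h.eval_adjB hv ht'.symm).2 h1, ?_⟩
    rw [Tm.eval, h.eval_pair hu, ← ht']
    exact (hW s t').2 h2

/-- The universal quantifier is written as not-exists-not. In the inner quantifier the variables 0,
1, 2, 3 are the answer, the new state of `A`, `s` and `t`. -/
theorem eval_stay (h : I.Describes A) (hW : Represents (A 4) W) (s : Fin n) (t : Fin m) :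
    Tm.stay.eval M A ((s * m + t) :: ρ) ≠ 0 ↔ (s, t) ∈ I.stay W := by
  have hn := I.left_lt_length
  have hm := I.right_lt_length
  rw [Tm.stay, Tm.eval, h.eval_div_pair s t rfl, h.eval_mod_pair s t rfl, Tm.eval_and_ne_zero,
    Tm.eval_not_ne_zero, Tm.eval_ex_ne_zero, Tm.eval.eq_3, h.eval_pair (s := s) rfl]
  refine and_congr (hW s t) ⟨fun H s' hs' => ?_, fun H => ?_⟩
  · by_contra hno
    refine H ⟨s', s'.2.trans hn, ?_⟩
    rw [Tm.eval_and_ne_zero, Tm.eval_and_ne_zero, Tm.eval_lt_ne_zero, h.eval_numA,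
      h.eval_adjA (s := s) (s' := s') rfl rfl, Tm.eval_not_ne_zero, Tm.eval_ex_ne_zero]
    refine ⟨⟨s'.2, hs'⟩, ?_⟩
    rintro ⟨i, -, hi⟩
    rw [h.eval_answer hW (s := s') (t := t) rfl rfl] at hi
    obtain ⟨t', -, ht'⟩ := hi
    exact hno ⟨t', ht'⟩
  · rintro ⟨i, -, hi⟩
    rw [Tm.eval_and_ne_zero, Tm.eval_and_ne_zero, Tm.eval_lt_ne_zero, h.eval_numA,
      Tm.eval_not_ne_zero, Tm.eval_ex_ne_zero] at hi
    obtain ⟨⟨hin, hadj⟩, hno⟩ := hi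
    rw [h.eval_adjA (s := s) (s' := ⟨i, hin⟩) rfl rfl] at hadj
    obtain ⟨t', ht'⟩ := H _ hadj
    refine hno ⟨t', t'.2.trans hm, ?_⟩
    rw [h.eval_answer hW (s := ⟨i, hin⟩) (t := t) rfl rfl]
    exact ⟨t', rfl, ht'⟩

/-- The new set is collected in array `7` before it is copied, so all joint states are tested
against the old set. -/
theorem represents_staySt (h : I.Describes A) (hW : Represents (A 4) W) :
    Represents (staySt.run M ρ A 4) (I.stay W) := by
  intro s t
  have hx : (s : ℕ) * m + t < M := (mul_add_lt_mul s t).trans I.mul_lt_length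
  rw [staySt, St.run, St.run_fill (by decide) hx, Tm.eval, Tm.eval, List.getD_cons_zero,
    St.run_fill (by decide) hx, h.eval_stay hW]

theorem represents_loop_staySt (h : I.Describes A) (hW : Represents (A 4) I.goal) :
    Represents ((St.loop staySt).run M ρ A 4) (I.stay^[M] I.goal) := by
  refine (St.run_loop_induction (fun r A' => I.Describes A' ∧
    Represents (A' 4) (I.stay^[r] I.goal)) ⟨h, hW⟩ ?_).2
  rintro r A' - ⟨h1, h2⟩
  refine ⟨h1.of_eq (St.run_of_notMem_targets (by simp [St.targets, staySt, St.fill]) _ _)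
    (St.run_of_notMem_targets (by simp [St.targets, staySt, St.fill]) _ _), ?_⟩
  rw [Function.iterate_succ_apply']
  exact h1.represents_staySt h2

theorem eval_table (h : I.Describes A) (hW : Represents (A 4) W) (s : Fin n) (t : Fin m) :
    ∃ t' : Fin m, Tm.table.eval M A ((s * m + t) :: ρ) = t' ∧
      ((∃ t', (t, t') ∈ I.domB.trans ∧ (s, t') ∈ W) → (t, t') ∈ I.domB.trans ∧ (s, t') ∈ W) := by
  classical
  have hm := I.right_lt_length
  have e : Tm.table.eval M A ((s * m + t) :: ρ) = ∑ i ∈ Finset.range M,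
      if (∃ t' : Fin m, (t' : ℕ) = i ∧ (t, t') ∈ I.domB.trans ∧ (s, t') ∈ W) ∧ ¬ ∃ j < M, j < i ∧
        (∃ t' : Fin m, (t' : ℕ) = j ∧ (t, t') ∈ I.domB.trans ∧ (s, t') ∈ W) then i else 0 := by
    rw [Tm.table, Tm.eval, h.eval_div_pair s t rfl, h.eval_mod_pair s t rfl, Tm.eval]
    refine Finset.sum_congr rfl fun i _ => ?_
    rw [Tm.eval]
    refine if_congr ?_ rfl rfl
    rw [Tm.eval_and_ne_zero, Tm.eval_not_ne_zero, Tm.eval_ex_ne_zero,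
      h.eval_answer hW (s := s) (t := t) rfl rfl]
    refine and_congr Iff.rfl (not_congr (exists_congr fun j => and_congr Iff.rfl ?_))
    rw [Tm.eval_and_ne_zero, Tm.eval_lt_ne_zero, h.eval_answer hW (s := s) (t := t) rfl rfl]
    rfl
  rw [e]
  rcases sum_first_eq M (fun i => ∃ t' : Fin m, (t' : ℕ) = i ∧ (t, t') ∈ I.domB.trans ∧
    (s, t') ∈ W) with ⟨h1, h2⟩ | ⟨t', h1, h2⟩
  -- Without an answer the entry is `0`, which is still a state because `B` has an initial state;
  -- the table is thus total.
  · refine ⟨⟨0, I.pos_right⟩, h2, ?_⟩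
    rintro ⟨t', ht'⟩
    exact absurd ⟨t', rfl, ht'⟩ (h1 t' (t'.2.trans hm))
  · exact ⟨t', h1.symm, fun _ => h2⟩

end Pointwise.Describes

/-! ## Output -/

/-- The output array contains the string that encodes a list of numbers. -/
structure Emitted (l : List ℕ) (A : Arrays) : Prop where
  length_eq : A 9 0 = (bits l).length
  apply_eq : ∀ q, A 1 q = ((bits l).getD q false).toNat

theorem Emitted.output_eq {l : List ℕ} {A : Arrays} (h : Emitted l A) :
    ((List.range (A 9 0)).map fun i => decide (A 1 i ≠ 0)) = bits l := by
  refine List.ext_getElem (by simp [h.length_eq]) fun i h1 h2 => ?_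
  simp only [List.getElem_map, List.getElem_range, h.apply_eq, List.getD_eq_getElem _ _ h2]
  cases (bits l)[i] <;> simp

/-- The entry of array `8` given by the innermost variable is put out. -/
def emitSt : St :=
  .seq (.loop (.ite (.lt (.var 0) (.read 8 (.var 1)))
      (.write 1 (.add (.read 9 (.const 0)) (.var 0)) (.const 1))))
    (.write 9 (.const 0) (.add (.read 9 (.const 0)) (.add (.read 8 (.var 0)) (.const 1))))

/-- Only the ones have to be written: array `1` is zero behind the output so far, so the closing
zero arises by advancing the length one further. The ones fit into a single loop because of `hN`. -/
theorem Emitted.run_emitSt {l : List ℕ} {A : Arrays} (h : Emitted l A) {N x : ℕ} {ρ : List ℕ}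
    (hN : A 8 x ≤ N) : Emitted (l ++ [A 8 x]) (emitSt.run N (x :: ρ) A) := by
  have hb : bits (l ++ [A 8 x]) = bits l ++ (List.replicate (A 8 x) true ++ [false]) := by
    rw [bits_append, bits_cons, bits_nil]
  obtain ⟨h8, h9, h1⟩ := St.run_loop_induction (N := N) (ρ := x :: ρ) (A := A)
    (c := .ite (.lt (.var 0) (.read 8 (.var 1)))
      (.write 1 (.add (.read 9 (.const 0)) (.var 0)) (.const 1)))
    (fun i A' => A' 8 = A 8 ∧ A' 9 = A 9 ∧ ∀ q, A' 1 q =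
      if A 9 0 ≤ q ∧ q < A 9 0 + min i (A 8 x) then 1 else A 1 q)
    ⟨rfl, rfl, fun q => by rw [if_neg]; omega⟩ (by
      rintro i A' hi ⟨h8, h9, h1⟩
      have hc : (Tm.lt (.var 0) (.read 8 (.var 1))).eval N A' (i :: x :: ρ) ≠ 0 ↔ i < A 8 x := by
        rw [Tm.eval_lt_ne_zero, ← h8]
        rfl
      refine ⟨(St.run_of_notMem_targets (by simp [St.targets]) _ _).trans h8,
        (St.run_of_notMem_targets (by simp [St.targets]) _ _).trans h9, fun q => ?_⟩
      rw [St.run]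
      by_cases hix : i < A 8 x
      · rw [if_pos (hc.2 hix)]
        simp only [St.run, Tm.eval, List.getD_cons_zero, Function.update_self, h9]
        rw [Function.update_apply, h1]
        split_ifs <;> first | rfl | omega
      · rw [if_neg (hc.not.2 hix), h1]
        refine if_congr ?_ rfl rfl
        omega)
  have e : min N (A 8 x) = A 8 x := by omega
  rw [e] at h1
  rw [emitSt, St.run]
  set A' := St.run N (x :: ρ) (.loop (.ite (.lt (.var 0) (.read 8 (.var 1)))
      (.write 1 (.add (.read 9 (.const 0)) (.var 0)) (.const 1)))) A
  refine ⟨?_, fun q => ?_⟩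
  · simp [St.run, Tm.eval, h8, h9, hb, h.length_eq]
  · rw [St.run_of_notMem_targets (by simp [St.targets]), h1, h.length_eq, hb]
    by_cases hq : q < (bits l).length
    · rw [if_neg (by omega), h.apply_eq, List.getD_append _ _ _ _ hq]
    · rw [List.getD_append_right _ _ _ _ (by omega)]
      by_cases hq' : q < (bits l).length + A 8 x
      · rw [if_pos (by omega), List.getD_append _ _ _ _ (by simp; omega),
          List.getD_eq_getElem _ _ (by simp; omega)]
        simp
      · rw [if_neg (by omega), List.getD_append_right _ _ _ _ (by simp; omega), h.apply_eq,
          List.getD_eq_default _ _ (by omega)]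
        -- Index 0 is the closing zero and later indices lie behind the string; both entries are
        -- `0`.
        rcases q - (bits l).length - (List.replicate (A 8 x) true).length with _ | k <;> simp

/-- The answer is put out. -/
def outputSt : St :=
  .seq (.write 9 (.const 0) (.const 1)) (.ite (.read 4 (.pair .initA .initB))
    (.seq (.write 1 (.const 0) (.const 1)) (.seq (.write 9 (.const 0) (.const 2))
      (.loop (.ite (.lt (.var 0) (.mul .numA .numB)) emitSt)))))

theorem tableCode_eq {n m : ℕ} (F : ℕ → ℕ) (f : Fin n → Fin m → Fin m)
    (h : ∀ (s : Fin n) (t : Fin m), F (s * m + t) = f s t) : (List.range (n * m)).map F = tableCode f := by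
  refine List.ext_getElem ?_ fun k h1 h2 => ?_
  · rw [tableCode, length_flatMap_finRange]
    simp
  · have hk : k < n * m := by simpa using h1
    have hm : 0 < m := Nat.pos_of_ne_zero fun h0 => by simp [h0] at hk
    have hs : k / m < n := (Nat.div_lt_iff_lt_mul hm).2 hk
    have hd : k / m * m + k % m = k := Nat.div_add_mod' k m
    have hg := getD_flatMap_finRange (fun s t => (f s t : ℕ)) ⟨k / m, hs⟩ ⟨k % m, Nat.mod_lt k hm⟩
    have hF := h ⟨k / m, hs⟩ ⟨k % m, Nat.mod_lt k hm⟩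
    simp only [hd] at hg hF
    rw [← List.getD_eq_getElem _ 0 h2, tableCode, hg, ← hF]
    simp

namespace Pointwise.Describes

variable {n m a b : ℕ} {I : Pointwise (Fin n) (Fin m) (Fin a) (Fin b)} {A : Arrays}
  {W : Set (Fin n × Fin m)}

/-- The string for `[0]` is a single zero, so length 1 and an untouched output array suffice. -/
theorem emitted_outputSt_of_notMem (h : I.Describes A) (hW : Represents (A 4) W)
    (h1 : A 1 = fun _ => 0) (h0 : (I.domA.init, I.domB.init) ∉ W) :
    Emitted [0] (outputSt.run I.input.length [] A) := by
  rw [outputSt, St.run]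
  set A' := St.run I.input.length [] (.write 9 (.const 0) (.const 1)) A with hA'
  have hD : I.Describes A' := h.of_eq (by simp [hA', St.run]) (by simp [hA', St.run])
  have h4 : A' 4 = A 4 := by simp [hA', St.run]
  rw [St.run, if_neg]
  · refine ⟨by simp [hA', St.run, Tm.eval, bits], fun q => ?_⟩
    have : A' 1 = A 1 := by simp [hA', St.run]
    rw [this, h1]
    rcases q with _ | q <;> simp [bits]
  · rwa [Tm.eval, hD.eval_pair hD.eval_initA, hD.eval_initB, h4, hW]

theorem emitted_outputSt_of_mem (h : I.Describes A) (hW : Represents (A 4) W)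
    (h1 : A 1 = fun _ => 0) (h0 : (I.domA.init, I.domB.init) ∈ W) {f : Fin n → Fin m → Fin m}
    (hf : ∀ (s : Fin n) (t : Fin m), A 8 (s * m + t) = f s t) :
    Emitted (1 :: tableCode f) (outputSt.run I.input.length [] A) := by
  have hlt := I.mul_lt_length
  rw [outputSt, St.run]
  set A' := St.run I.input.length [] (.write 9 (.const 0) (.const 1)) A with hA'
  have hD : I.Describes A' := h.of_eq (by simp [hA', St.run]) (by simp [hA', St.run])
  have h4 : A' 4 = A 4 := by simp [hA', St.run]
  rw [St.run, if_pos, St.run, St.run]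
  · set A₁ := St.run I.input.length [] (.write 9 (.const 0) (.const 2))
      (St.run I.input.length [] (.write 1 (.const 0) (.const 1)) A') with hA₁
    have hD₁ : I.Describes A₁ := hD.of_eq (by simp [hA₁, St.run]) (by simp [hA₁, St.run])
    have h8 : A₁ 8 = A 8 := by simp [hA₁, hA', St.run]
    have hE : Emitted [1] A₁ := by
      refine ⟨by simp [hA₁, St.run, Tm.eval, bits], fun q => ?_⟩
      simp only [hA₁, hA', St.run, Tm.eval, bits]
      rcases q with _ | _ | q <;> simp [h1]
    have key := St.run_loop_induction (N := I.input.length) (ρ := []) (A := A₁)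
      (c := .ite (.lt (.var 0) (.mul .numA .numB)) emitSt)
      (fun x A' => I.Describes A' ∧ A' 8 = A 8 ∧
        Emitted (1 :: ((List.range (min x (n * m))).map (A 8))) A')
      ⟨hD₁, h8, by simpa using hE⟩ ?_
    · rw [min_eq_right hlt.le, tableCode_eq _ f hf] at key
      exact key.2.2
    · rintro x A' hx ⟨k1, k2, k3⟩
      refine ⟨k1.of_eq (St.run_of_notMem_targets (by simp [St.targets, emitSt]) _ _)
        (St.run_of_notMem_targets (by simp [St.targets, emitSt]) _ _),
        (St.run_of_notMem_targets (by simp [St.targets, emitSt]) _ _).trans k2, ?_⟩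
      have hc : (Tm.lt (.var 0) (.mul .numA .numB)).eval I.input.length A' [x] ≠ 0 ↔
          x < n * m := by
        rw [Tm.eval_lt_ne_zero, Tm.eval_mul (by rw [k1.eval_numA]; exact I.left_lt_length.le),
          k1.eval_numA, k1.eval_numB]
        rfl
      rw [St.run]
      by_cases hxm : x < n * m
      · rw [if_pos (hc.2 hxm), min_eq_left (by omega), List.range_succ, List.map_append,
          List.map_singleton, ← List.cons_append, ← k2]
        rw [min_eq_left (by omega), ← k2] at k3
        refine k3.run_emitSt ?_
        have hm : 0 < m := I.pos_right
        -- A table entry is a state of `B`, hence smaller than the loop length, as `run_emitSt`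
        -- requires.
        have := hf ⟨x / m, (Nat.div_lt_iff_lt_mul hm).2 hxm⟩ ⟨x % m, Nat.mod_lt x hm⟩
        simp only [Nat.div_add_mod'] at this
        rw [k2, this]
        exact (Fin.is_lt _).le.trans I.right_lt_length.le
      · rw [if_neg (hc.not.2 hxm)]
        rwa [min_eq_right (by omega)] at k3 ⊢
  · rwa [Tm.eval, hD.eval_pair hD.eval_initA, hD.eval_initB, h4, hW]

end Pointwise.Describes

/-! ## The decision procedure -/

/-- The algorithm. -/
def solveSt : St :=
  .seq decodeSt (.seq goalSt (.seq (.loop staySt) (.seq (St.fill 8 .table) outputSt)))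

namespace Pointwise

variable {n m a b : ℕ} (I : Pointwise (Fin n) (Fin m) (Fin a) (Fin b))

/-- `W` is the largest winning set. If it contains the initial joint state, the computed table keeps
the play in it; otherwise no winning set contains that state. -/
theorem output_solveSt :
    ((¬ ∃ σ, I.toProblem.IsSolution σ) ∧ solveSt.output I.input = bits [0]) ∨
      ∃ f : Fin n → Fin m → Fin m, I.toProblem.IsSolution (I.tableStrategy f) ∧
        solveSt.output I.input = bits (1 :: tableCode f) := by
  set M := I.input.length with hM
  set W := I.stay^[M] I.goal with hWdef
  have hWin : I.IsWinSet W := I.isWinSet_iterate_stay (by simpa using I.mul_lt_length)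
  set A₀ := (Store.ofInput I.input).arr with hA₀
  set A₁ := decodeSt.run M [] A₀ with hA₁
  set A₂ := goalSt.run M [] A₁ with hA₂
  set A₃ := (St.loop staySt).run M [] A₂ with hA₃
  set A₄ := (St.fill 8 .table).run M [] A₃ with hA₄
  have hout : solveSt.output I.input = (List.range (outputSt.run M [] A₄ 9 0)).map
      fun i => decide (outputSt.run M [] A₄ 1 i ≠ 0) := rfl
  have d₁ : I.Describes A₁ := describes_run_decodeSt I
  have d₂ : I.Describes A₂ := d₁.of_eq
    (St.run_of_notMem_targets (by simp [goalSt, tokensSt, tokenSt, St.targets]) _ _)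
    (St.run_of_notMem_targets (by simp [goalSt, tokensSt, tokenSt, St.targets]) _ _)
  have d₃ : I.Describes A₃ := d₂.of_eq
    (St.run_of_notMem_targets (by simp [staySt, St.fill, St.targets]) _ _)
    (St.run_of_notMem_targets (by simp [staySt, St.fill, St.targets]) _ _)
  have d₄ : I.Describes A₄ := d₃.of_eq
    (St.run_of_notMem_targets (by simp [St.fill, St.targets]) _ _)
    (St.run_of_notMem_targets (by simp [St.fill, St.targets]) _ _)
  have w₃ : Represents (A₃ 4) W := d₂.represents_loop_staySt fun s t => d₁.run_goalSt [] s t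
  have w₄ : Represents (A₄ 4) W := by
    rwa [hA₄, St.run_of_notMem_targets (by simp [St.fill, St.targets])]
  have z₄ : A₄ 1 = fun _ => 0 := by
    rw [hA₄, St.run_of_notMem_targets (by simp [St.fill, St.targets]),
      hA₃, St.run_of_notMem_targets (by simp [staySt, St.fill, St.targets]),
      hA₂, St.run_of_notMem_targets (by simp [goalSt, tokensSt, tokenSt, St.targets]),
      hA₁, St.run_of_notMem_targets (by simp [decodeSt, St.targets])]
    rfl
  by_cases h0 : (I.domA.init, I.domB.init) ∈ W
  · right
    -- The table is evaluated on the arrays before the filling; `run_fill` transfers the values to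
    -- array `8`.
    choose f hf hf' using fun (s : Fin n) (t : Fin m) => d₃.eval_table (ρ := []) w₃ s t
    refine ⟨f, hWin.isSolution_tableStrategy I h0 ?_, ?_⟩
    · intro s t hst s' hs'
      exact hf' s' t (hWin.exists_response s t hst s' hs')
    · rw [hout]
      refine (d₄.emitted_outputSt_of_mem w₄ z₄ h0 fun s t => ?_).output_eq
      rw [hA₄, St.run_fill (by decide) ((mul_add_lt_mul s t).trans I.mul_lt_length), hf]
  · left
    refine ⟨?_, ?_⟩
    · rw [exists_isSolution_iff]
      rintro ⟨W', hW', h0'⟩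
      exact h0 (hW'.subset_iterate_stay I M h0')
    · rw [hout]
      exact (d₄.emitted_outputSt_of_notMem w₄ z₄ h0).output_eq

end Pointwise

/-! ## The length of the input -/

theorem length_bits_append (l l' : List ℕ) :
    (bits (l ++ l')).length = (bits l).length + (bits l').length := by
  rw [bits_append, List.length_append]

theorem length_bits_cons (v : ℕ) (l : List ℕ) :
    (bits (v :: l)).length = v + 1 + (bits l).length := by
  rw [bits_cons]
  simp
  omega

theorem length_bits_table_le {n m : ℕ} (P : Fin n → Fin m → Prop) [∀ s t, Decidable (P s t)] :
    (bits ((List.finRange n).flatMap fun s => (List.finRange m).map fun t =>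
      if P s t then 1 else 0)).length ≤ n * m * 2 := by
  rw [length_bits]
  refine (List.sum_le_card_nsmul _ 2 ?_).trans ?_
  · intro x hx
    simp only [List.mem_map, List.mem_flatMap] at hx
    obtain ⟨_, ⟨s, -, t, -, rfl⟩, rfl⟩ := hx
    split_ifs <;> omega
  · rw [List.length_map, length_flatMap_finRange, smul_eq_mul]

theorem Domain.length_bits_code_le {n a q : ℕ} (D : Domain (Fin n) (Fin a)) (hn : n ≤ q)
    (ha : a ≤ q) : (bits D.code).length ≤ 4 * (q * q) + 3 * q + 3 := by
  have h1 := length_bits_table_le fun s s' : Fin n => (s, s') ∈ D.trans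
  have h2 := length_bits_table_le fun (s : Fin n) (p : Fin a) => p ∈ D.label s
  have h3 : n * n ≤ q * q := Nat.mul_le_mul hn hn
  have h4 : n * a ≤ q * q := Nat.mul_le_mul hn ha
  have h5 := D.init.2
  rw [code, length_bits_append, length_bits_append]
  simp only [length_bits_cons, bits_nil, List.length_nil]
  omega

/-- The connectives are unary or binary, so there are at most `2 * φ.size + 1` tokens, and each
takes at most `q + 4` bits. -/
theorem BoolFormula.length_bits_go_le {a q : ℕ} (ha : a ≤ q) (φ : BoolFormula (Fin a)) :
    (bits (code.go φ)).length ≤ (2 * φ.size + 1) * (q + 4) := by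
  induction φ with
  | atom p =>
    have := p.2
    simp only [code.go, length_bits_cons, bits_nil, List.length_nil, size]
    omega
  | neg φ ih =>
    simp only [code.go, length_bits_append, length_bits_cons, bits_nil, List.length_nil, size]
    linarith
  | and φ ψ ih ih' | or φ ψ ih ih' =>
    simp only [code.go, length_bits_append, length_bits_cons, bits_nil, List.length_nil, size]
    linarith

theorem BoolFormula.length_bits_code_le {a q : ℕ} (ha : a ≤ q) (φ : BoolFormula (Fin a)) :
    (bits φ.code).length ≤ (2 * φ.size + 2) * (q + 4) := by
  have h := φ.length_bits_go_le ha
  rw [code, length_bits_append, length_bits_cons, bits_nil, List.length_nil]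
  linarith

namespace Pointwise

variable {n m a b : ℕ} (I : Pointwise (Fin n) (Fin m) (Fin a) (Fin b))

/-- The two connectives "always" and "implies" of a clause pay for the closing tokens of its two
formulas, and keep the number of clauses bounded by the size. -/
theorem length_bits_clauses_le {q : ℕ} (ha : a ≤ q) (hb : b ≤ q)
    (l : List (BoolFormula (Fin a) × BoolFormula (Fin b))) :
    l.length ≤ (l.map fun c => c.1.size + c.2.size + 2).sum ∧
      (bits (l.flatMap fun c => c.1.code ++ c.2.code)).length ≤
        2 * (l.map fun c => c.1.size + c.2.size + 2).sum * (q + 4) := by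
  induction l with
  | nil => simp [bits_nil]
  | cons c l ih =>
    have h1 := c.1.length_bits_code_le ha
    have h2 := c.2.length_bits_code_le hb
    simp only [List.length_cons, List.map_cons, List.sum_cons, List.flatMap_cons,
      length_bits_append]
    exact ⟨by omega, by linarith [ih.2]⟩

/-- Each domain contributes `4 * q ^ 2 + 3 * q + 3`, the number of clauses at most `q + 1`, and the
tokens `2 * q * (q + 4)`. -/
theorem length_input_le : I.input.length ≤
    10 * (I.domSize + I.mapSize) ^ 2 + 15 * (I.domSize + I.mapSize) + 7 := by
  set q := I.domSize + I.mapSize with hq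
  have hd : n + a + m + b ≤ q := by
    simp only [hq, domSize, Domain.size, Fintype.card_fin]
    omega
  have hk : (I.maps.map fun c => c.1.size + c.2.size + 2).sum ≤ q := by
    simp only [hq, mapSize]
    omega
  have hA := I.domA.length_bits_code_le (q := q) (by omega) (by omega)
  have hB := I.domB.length_bits_code_le (q := q) (by omega) (by omega)
  obtain ⟨h1, h2⟩ := length_bits_clauses_le (q := q) (by omega) (by omega) I.maps
  have h3 := h2.trans (Nat.mul_le_mul_right (q + 4) (Nat.mul_le_mul_left 2 hk))
  rw [input_eq, code, length_bits_append, length_bits_append, length_bits_cons, tokens]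
  linarith [sq q]

theorem SolvedWithin.mono {I : Pointwise (Fin n) (Fin m) (Fin a) (Fin b)} {c : Program}
    {k k' : ℕ} (h : I.SolvedWithin c k) (hk : k ≤ k') : I.SolvedWithin c k' := by
  have hc : ∀ w w', Computes c w w' k → Computes c w w' k' := fun _ _ ⟨s, j, he, hj, hw⟩ =>
    ⟨s, j, he, hj.trans hk, hw⟩
  exact h.imp (fun h => ⟨h.1, hc _ _ h.2⟩) fun ⟨f, hf, h⟩ => ⟨f, hf, hc _ _ h⟩

end Pointwise

/-! ### Polynomial bounds in the sizes of the domains and of the specification. -/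

theorem polynomial_eval_mono (p : Polynomial ℕ) : Monotone fun x => p.eval x := by
  intro x y h
  simp only [Polynomial.eval_eq_sum_range]
  gcongr

theorem exists_polynomial_solvedWithin : ∃ p : Polynomial ℕ, ∀ {n m a b : ℕ}
    (I : Pointwise (Fin n) (Fin m) (Fin a) (Fin b)),
    I.SolvedWithin solveSt.program (p.eval (I.domSize + I.mapSize)) := by
  obtain ⟨p, hp⟩ := solveSt.computes_program
  refine ⟨p.comp (10 * Polynomial.X ^ 2 + 15 * Polynomial.X + 7), fun I => ?_⟩
  have hs : I.SolvedWithin solveSt.program (p.eval I.input.length) := by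
    have h := hp I.input
    rcases I.output_solveSt with ⟨h1, h2⟩ | ⟨f, hf, h2⟩
    · exact Or.inl ⟨h1, h2 ▸ h⟩
    · exact Or.inr ⟨f, hf, h2 ▸ h⟩
  refine hs.mono ((polynomial_eval_mono p I.length_input_le).trans (le_of_eq ?_))
  simp [Polynomial.eval_comp]

end MBSD

theorem mainTheorem4 :
    (∀ {S T PA PB : Type*} [Finite S] [Finite T] [Finite PA] [Finite PB]
      (I : MBSD.Pointwise S T PA PB),
      (∃ σ, I.toProblem.IsSolution σ) ↔ ∃ σ, I.arena.WinsSafe I.goal σ) ∧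
    ∃ c : MBSD.Program,
      (∃ p : Polynomial ℕ, ∀ {n m a b : ℕ}
        (I : MBSD.Pointwise (Fin n) (Fin m) (Fin a) (Fin b)),
        I.SolvedWithin c (p.eval (I.domSize + I.mapSize))) ∧
      (∀ d : ℕ, ∃ p : Polynomial ℕ, ∀ {n m a b : ℕ}
        (I : MBSD.Pointwise (Fin n) (Fin m) (Fin a) (Fin b)),
        I.domSize ≤ d → I.SolvedWithin c (p.eval I.mapSize)) ∧
      (∀ d : ℕ, ∃ p : Polynomial ℕ, ∀ {n m a b : ℕ}
        (I : MBSD.Pointwise (Fin n) (Fin m) (Fin a) (Fin b)),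
        I.mapSize ≤ d → I.SolvedWithin c (p.eval I.domSize)) := by
  refine ⟨fun I => I.exists_isSolution_iff_exists_winsSafe, ?_⟩
  obtain ⟨p, hp⟩ := MBSD.exists_polynomial_solvedWithin
  refine ⟨MBSD.solveSt.program, ⟨p, hp⟩, fun d => ?_, fun d => ?_⟩
  -- Polynomials over the natural numbers are monotone, so the bounded summand may be replaced by
  -- `d`.
  · refine ⟨p.comp (Polynomial.X + Polynomial.C d), fun I hI => (hp I).mono ?_⟩
    rw [Polynomial.eval_comp]
    exact MBSD.polynomial_eval_mono p (by simp; omega)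
  · refine ⟨p.comp (Polynomial.X + Polynomial.C d), fun I hI => (hp I).mono ?_⟩
    rw [Polynomial.eval_comp]
    exact MBSD.polynomial_eval_mono p (by simp; omega)
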